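/- Let $G$ be a finite simple graph with vertex set $V$, let $d\ge 0$, and let $S$ be a subgroup of the orthogonal group $O(\mathbb{E}^d)$. **Conventions.** For a graph $H$ and a subgroup $T\le O(\mathbb{E}^m)$, a configuration $r:V(H)\to\mathbb{E}^m$ is *of type* $\Phi:T\to \mathrm{Aut}(H)$ if $x(r_i)=r_{\Phi(x)(i)}$ for all $x\in T$, $i\in V(H)$; these configurations form a linear space $\mathscr{P}_{(H,T,\Phi)}$. A framework $(H,r)$ *has symmetry* $T$ if $r$ is injective and of type $\Phi$ for some $\Phi$; this $\Phi$ is then unique. Let $f_H(r)=(\|r_i-r_j\|^2)_{\{i,j\}\in E(H)}$. The configuration $r$ of type $\Phi$ is a *$T$-regular point of $H$* if the rank of the derivative of $f_H|_{\mathscr{P}_{(H,T,\Phi)}}$ attains its maximum over $\mathscr{P}_{(H,T,\Phi)}$ at $r$. A *$T$-symmetric finite flex* of $(H,r)$ is an analytic path $x:[0,1]\to(\mathbb{E}^m)^{V(H)}$ with $x(0)=r$, such that for all $t\in[0,1]$, $x(t)$ is of type $\Phi$ and $f_H(x(t))=f_H(r)$, and such that for every $t\in(0,1]$ the configuration $x(t)$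 is not congruent to $r$, i.e. $\|x_i(t)-x_j(t)\|\neq\|r_i-r_j\|$ for some vertices $i,j$. It is a flex *in* a subset $X\subseteq\mathbb{E}^m$ if moreover all $x_i(t)\in X$. For $x\in O(\mathbb{E}^d)$ let $x^*\in O(\mathbb{E}^{d+1})$ be $x^*(v,c)=(x(v),c)$, and let $S^*=\{x^*:x\in S\}$. The cone graph $G*o$ is obtained from $G$ by adding a vertex $o$ adjacent to all vertices of $G$. For $w\in\mathbb{E}^{d+1}$ with $w_{d+1}\ne0$ let $\pi(w)=(w_1,\dots,w_d)/w_{d+1}$ be the central projection from the origin to the hyperplane $x_{d+1}=1$, identified with $\mathbb{E}^d$. Let $\mathbb{S}^d$ be the unit sphere of $\mathbb{E}^{d+1}$ and $\mathbb{S}^d_+$ its open upper half $x_{d+1}>0$. **Theorem (Transfer of finite flexes through coning).** Let $(G,p)$ be a framework in $\mathbb{E}^d$ with symmetry $S$ such that $p$ is an $S$-regular point of $G$. Let $q:V\to\mathbb{E}^{d+1}$ satisfy $(q_i)_{d+1}\neq0$ and $\pi(q_i)=p_i$ for all $i\in V$, and suppose that the cone framework $(G*o,q)$ with the joint of $o$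 at the origin has symmetry $S^*$. Then: 1. $(G,p)$ has an $S$-symmetric finite flex in $\mathbb{E}^d$ if and only if $(G*o,q)$ has an $S^*$-symmetric finite flex in $\mathbb{E}^{d+1}$; 2. equivalently, if and only if $(G*o,q)$ has an $S^*$-symmetric finite flex in $\mathbb{E}^{d+1}$ along which the cone joint stays at the origin; 3. if all $q_i\in\mathbb{S}^d$, then $(G,p)$ has an $S$-symmetric finite flex in $\mathbb{E}^d$ if and only if $(G,q)$ has an $S^*$-symmetric finite flex in $\mathbb{S}^d$; 4. if all $q_i\in\mathbb{S}^d_+$, then $(G,p)$ has an $S$-symmetric finite flex in $\mathbb{E}^d$ if and only if $(G,q)$ has an $S^*$-symmetric finite flex in $\mathbb{S}^d_+$. -/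

import Mathlib

noncomputable section

namespace ConeFlex

/-- Euclidean `d`-space. -/
abbrev E (d : ℕ) : Type := EuclideanSpace ℝ (Fin d)

/-- The orthogonal group of Euclidean `d`-space. -/
abbrev O (d : ℕ) : Type := E d ≃ₗᵢ[ℝ] E d

/-- The edge function `f_G`, sending a configuration to the squared lengths of the edges of `G`. -/
def edgeFunction {V : Type*} {m : ℕ} (G : SimpleGraph V) (p : V → E m) : G.edgeSet → ℝ :=
  fun e => Sym2.lift ⟨fun i j => ‖p i - p j‖ ^ 2, fun i j => by simp only [norm_sub_rev]⟩ e.1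

/-- The space `𝒫_(G,S,Φ)` of all configurations `p` with `x (p i) = p (Φ x i)` for all vertices
`i` and all `x ∈ S`. -/
def symConfig {V : Type*} {m : ℕ} (G : SimpleGraph V) (S : Subgroup (O m)) (Φ : S → (G ≃g G)) :
    Submodule ℝ (V → E m) where
  carrier := {p | ∀ (x : S) (i : V), (x : O m) (p i) = p (Φ x i)}
  add_mem' := fun {p q} hp hq x i => by simp [hp x i, hq x i]
  zero_mem' := fun x i => by simp
  smul_mem' := fun c p hp x i => by simp [hp x i]

/-- `(G, p) ∈ ℛ_(G,S)`: `p` is an embedding of the vertices, and `(G, p)` is of type `Φ` for some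
`Φ : S → Aut G`. -/
def IsRealization {V : Type*} {m : ℕ} (G : SimpleGraph V) (S : Subgroup (O m)) (p : V → E m) :
    Prop :=
  Function.Injective p ∧ ∃ Φ : S → (G ≃g G), p ∈ symConfig G S Φ

/-- The type of an injective configuration is unique (so `∃ Φ` below means "for the type `Φ` of
the framework"). -/
theorem type_unique {V : Type*} {m : ℕ} {G : SimpleGraph V} {S : Subgroup (O m)} {p : V → E m}
    (hp : Function.Injective p) {Φ Ψ : S → (G ≃g G)} (hΦ : p ∈ symConfig G S Φ)
    (hΨ : p ∈ symConfig G S Ψ) : Φ = Ψ := by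
  funext x
  ext i
  exact hp ((hΦ x i).symm.trans (hΨ x i))

open Classical in
/-- The rank of the derivative at `p` of the restriction of the edge function to
`𝒫_(G,S,Φ)`. -/
def symRank {V : Type*} [Fintype V] {m : ℕ} (G : SimpleGraph V) (S : Subgroup (O m))
    (Φ : S → (G ≃g G)) (p : symConfig G S Φ) : ℕ :=
  Module.finrank ℝ (LinearMap.range
    (fderiv ℝ (fun r : symConfig G S Φ => edgeFunction G (r : V → E m)) p).toLinearMap)

/-- `p` is an `S`-regular point of `G`: the rank of the derivative of the restricted edge function
is maximal at `p` among all configurations of the same type. -/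
def IsSRegularPoint {V : Type*} [Fintype V] {m : ℕ} (G : SimpleGraph V) (S : Subgroup (O m))
    (p : V → E m) : Prop :=
  ∃ (Φ : S → (G ≃g G)) (hp : p ∈ symConfig G S Φ),
    ∀ r : symConfig G S Φ, symRank G S Φ r ≤ symRank G S Φ ⟨p, hp⟩

/-- `(G, p)` has an `S`-symmetric finite flex inside the set `A` of configurations: an analytic
path `x` on `[0,1]` starting at `p`, along which the configuration stays in `A`, keeps the type of
`(G, p)`, keeps all edge lengths of `G`, and is not congruent to `p` at any `t ∈ (0,1]`. -/
def HasSymFlexIn {V : Type*} [Fintype V] {m : ℕ} (A : Set (V → E m)) (G : SimpleGraph V)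
    (S : Subgroup (O m)) (p : V → E m) : Prop :=
  ∃ Φ : S → (G ≃g G), p ∈ symConfig G S Φ ∧
    ∃ x : ℝ → V → E m, AnalyticOnNhd ℝ x (Set.Icc 0 1) ∧ x 0 = p ∧
      (∀ t ∈ Set.Icc (0 : ℝ) 1,
        x t ∈ A ∧ x t ∈ symConfig G S Φ ∧ edgeFunction G (x t) = edgeFunction G p) ∧
      ∀ t ∈ Set.Ioc (0 : ℝ) 1,
        edgeFunction (⊤ : SimpleGraph V) (x t) ≠ edgeFunction (⊤ : SimpleGraph V) p

/-- An `S`-symmetric finite flex of `(G, p)` in Euclidean space. -/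
def HasSymFlex {V : Type*} [Fintype V] {m : ℕ} (G : SimpleGraph V) (S : Subgroup (O m))
    (p : V → E m) : Prop :=
  HasSymFlexIn Set.univ G S p

/-- Configurations on the unit sphere `𝕊^d` of `E (d + 1)`. Keeping (not keeping) the chordal
distance of two points of the sphere is the same as keeping (not keeping) their spherical
distance. -/
def sphereConfig (V : Type*) (d : ℕ) : Set (V → E (d + 1)) :=
  {x | ∀ i, ‖x i‖ = 1}

/-- Configurations on the open upper half `𝕊^d_+` of the unit sphere. -/
def hemisphereConfig (V : Type*) (d : ℕ) : Set (V → E (d + 1)) :=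
  {x | ∀ i, ‖x i‖ = 1 ∧ 0 < x i (Fin.last d)}

/-- The point `(v, c)` of `E (d + 1)`. -/
def snocPt {d : ℕ} (v : E d) (c : ℝ) : E (d + 1) :=
  WithLp.toLp 2 (Fin.snoc (α := fun _ => ℝ) (fun k => v k) c)

/-- The first `d` coordinates of a point of `E (d + 1)`. -/
def initPt {d : ℕ} (w : E (d + 1)) : E d :=
  WithLp.toLp 2 (fun k => w (Fin.castSucc k))

theorem initPt_snocPt {d : ℕ} (v : E d) (c : ℝ) : initPt (snocPt v c) = v := by
  ext k; simp [initPt, snocPt]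

theorem snocPt_last {d : ℕ} (v : E d) (c : ℝ) : snocPt v c (Fin.last d) = c := by
  simp [snocPt]

theorem snocPt_initPt {d : ℕ} (w : E (d + 1)) : snocPt (initPt w) (w (Fin.last d)) = w := by
  ext k
  refine Fin.lastCases ?_ (fun k => ?_) k <;> simp [initPt, snocPt]

theorem norm_snocPt_sq {d : ℕ} (v : E d) (c : ℝ) : ‖snocPt v c‖ ^ 2 = ‖v‖ ^ 2 + c ^ 2 := by
  simp [EuclideanSpace.norm_sq_eq, Fin.sum_univ_castSucc, snocPt]

/-- The orthogonal transformation `x^*` of `E (d + 1)`, `(v, c) ↦ (x v, c)`, whose matrix is the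
block matrix with blocks `M_x` and `1`. -/
def starElem {d : ℕ} (x : O d) : O (d + 1) where
  toFun w := snocPt (x (initPt w)) (w (Fin.last d))
  invFun w := snocPt (x.symm (initPt w)) (w (Fin.last d))
  map_add' v w := by
    have h : initPt (v + w) = initPt v + initPt w := by ext k; simp [initPt]
    ext k
    refine Fin.lastCases ?_ (fun k => ?_) k <;> simp [snocPt, h]
  map_smul' c w := by
    have h : initPt (c • w) = c • initPt w := by ext k; simp [initPt]
    ext k
    refine Fin.lastCases ?_ (fun k => ?_) k <;> simp [snocPt, h]
  left_inv w := by simp [initPt_snocPt, snocPt_last, snocPt_initPt]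
  right_inv w := by simp [initPt_snocPt, snocPt_last, snocPt_initPt]
  norm_map' w := by
    change ‖snocPt (x (initPt w)) (w (Fin.last d))‖ = ‖w‖
    have h : ‖w‖ ^ 2 = ‖initPt w‖ ^ 2 + w (Fin.last d) ^ 2 := by
      rw [← norm_snocPt_sq, snocPt_initPt]
    rw [← sq_eq_sq₀ (norm_nonneg _) (norm_nonneg _), norm_snocPt_sq, h, x.norm_map]

/-- `x ↦ x^*` as a homomorphism. -/
def starHom (d : ℕ) : O d →* O (d + 1) where
  toFun := starElem
  map_one' := by
    ext1 w
    exact snocPt_initPt w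
  map_mul' x y := by
    ext1 w
    change snocPt (x (y (initPt w))) _ = snocPt (x (initPt (snocPt (y (initPt w)) _))) _
    rw [initPt_snocPt]
    exact congrArg _ (snocPt_last _ _).symm

/-- The group `S^* = {x^* : x ∈ S}`. -/
def starGroup {d : ℕ} (S : Subgroup (O d)) : Subgroup (O (d + 1)) :=
  S.map (starHom d)

/-- The cone graph `G * o`; the cone vertex `o` is `none`. -/
def coneGraph {V : Type*} (G : SimpleGraph V) : SimpleGraph (Option V) where
  Adj
    | none, none => False
    | none, some _ => True
    | some _, none => True
    | some i, some j => G.Adj i j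
  symm := ⟨by
    rintro (_ | i) (_ | j) h
    · exact h
    · trivial
    · trivial
    · exact G.adj_symm h⟩
  loopless := ⟨by
    rintro (_ | i) h
    · exact h
    · exact G.loopless.irrefl i h⟩

/-- The cone configuration: the joints `q i`, with the cone joint `o` at the origin. -/
def coneConfig {V : Type*} {d : ℕ} (q : V → E (d + 1)) : Option V → E (d + 1) :=
  fun o => o.elim 0 q

/-- The central projection of a point from the origin to the hyperplane `x_{d+1} = 1`, identified
with `E d` (meaningful for points whose last coordinate is nonzero). -/
def proj {d : ℕ} (w : E (d + 1)) : E d :=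
  (w (Fin.last d))⁻¹ • initPt w

end ConeFlex

end

/-! The proof passes through infinitesimal flexes, following Asimow and Roth within the space of
configurations of a fixed type. If every symmetric infinitesimal flex at `p` is a rigid motion,
semicontinuity of rank propagates this to nearby configurations, so the velocities of a flex
starting at `p` are rigid, distances are stationary, and the flex cannot exist
(`not_infFlex_le_of_hasSymFlex`; no regularity needed). Conversely, if the space of infinitesimal
flexes has locally minimal dimension at `p`, the constant rank theorem integrates a nontrivial one
to an analytic curve with constant edge lengths. By analyticity this curve is either congruent to
`p` for all small times, which would make its initial velocity rigid, or for no small nonzero time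
(`hasSymFlex_of_not_infFlex_le`).

It remains to compare a cone configuration `w` with its central projection. When no joint lies at
the height of the cone joint, `coneLift` identifies pairs (`S^*`-fixed translation, infinitesimal
flex of the projection) with infinitesimal flexes of `w`, and rigid motions correspond to rigid
motions. The dimensions thus differ by a constant independent of `w`, so both minimality and the
existence of a nontrivial infinitesimal flex pass between base and cone (`hasSymFlex_iff_cone`).

The remaining equivalences act on paths: subtracting the motion of the cone joint pins it at the
origin, unit cone edges then amount to lying on the sphere, and shortening the path keeps it in the
open half-sphere. -/

namespace ConeFlex

open Filter Topology

/-! ### Semicontinuity of rank and the analytic constant rank theorem. -/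

section ConstantRank

variable {P W : Type*}
  [NormedAddCommGroup P] [NormedSpace ℝ P]
  [NormedAddCommGroup W] [NormedSpace ℝ W]

/-- The rank of a continuous family of linear maps is lower semicontinuous. -/
theorem eventually_finrank_range_le {X T : Type*} [NormedAddCommGroup X] [NormedSpace ℝ X]
    [FiniteDimensional ℝ X] [TopologicalSpace T] {F : T → X →L[ℝ] W} {p : T}
    (hF : ContinuousAt F p) :
    ∀ᶠ r in 𝓝 p, Module.finrank ℝ (LinearMap.range (F p).toLinearMap) ≤
      Module.finrank ℝ (LinearMap.range (F r).toLinearMap) := by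
  have hopen := _root_.isOpen_setOfPred_nat_le_rank (𝕜 := ℝ) (E := X) (F := W)
    (Module.finrank ℝ (LinearMap.range (F p).toLinearMap))
  have key : ∀ r, ((Module.finrank ℝ (LinearMap.range (F p).toLinearMap) : ℕ) : Cardinal) ≤
      (F r : X →ₗ[ℝ] W).rank ↔ Module.finrank ℝ (LinearMap.range (F p).toLinearMap) ≤
      Module.finrank ℝ (LinearMap.range (F r).toLinearMap) := by
    intro r
    rw [LinearMap.rank, ← Module.finrank_eq_rank, Nat.cast_le]
  have := hF.preimage_mem_nhds (hopen.mem_nhds ((key p).2 le_rfl))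
  filter_upwards [this] with r hr
  exact (key r).1 hr

/-- In finite dimension pointwise continuity suffices: a basis replaces `X` by a coordinate space,
on which a pointwise continuous family of operators is norm continuous. -/
theorem eventually_finrank_range_le_of_linearMap {X T : Type*} [AddCommGroup X] [Module ℝ X]
    [FiniteDimensional ℝ X] [TopologicalSpace T] {F : T → X →ₗ[ℝ] W}
    (hF : ∀ v, Continuous fun r => F r v) (p : T) :
    ∀ᶠ r in 𝓝 p, Module.finrank ℝ (LinearMap.range (F p)) ≤
      Module.finrank ℝ (LinearMap.range (F r)) := by
  let e := (Module.finBasis ℝ X).equivFun.symm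
  have hrange : ∀ r, LinearMap.range (F r ∘ₗ e.toLinearMap) = LinearMap.range (F r) := fun r =>
    LinearMap.range_comp_of_range_eq_top _ e.range
  let F' : T → (Fin (Module.finrank ℝ X) → ℝ) →L[ℝ] W := fun r =>
    LinearMap.toContinuousLinearMap (F r ∘ₗ e.toLinearMap)
  have hF' : Continuous F' := continuous_clm_apply.2 fun v => hF (e v)
  filter_upwards [eventually_finrank_range_le (hF'.continuousAt (x := p))] with r hr
  rw [← hrange p, ← hrange r]
  exact hr

/-- If the kernel of the derivative of an analytic map `f` has minimal dimension at `p` among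
nearby points, every vector of this kernel is the velocity of an analytic curve in the fibre
of `f` through `p`. -/
theorem exists_analytic_curve_in_fibre [FiniteDimensional ℝ P] [FiniteDimensional ℝ W] {f : P → W}
    (hf : ContDiff ℝ ⊤ f) {p : P}
    (hker : ∀ᶠ r in 𝓝 p, Module.finrank ℝ (LinearMap.ker (fderiv ℝ f p).toLinearMap) ≤
      Module.finrank ℝ (LinearMap.ker (fderiv ℝ f r).toLinearMap))
    {u : P} (hu : fderiv ℝ f p u = 0) :
    ∃ c : ℝ → P, AnalyticAt ℝ c 0 ∧ c 0 = p ∧ HasDerivAt c u 0 ∧ ∀ᶠ t in 𝓝 0, f (c t) = f p := by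
  have hdiff : Differentiable ℝ f := hf.differentiable (by simp)
  set A := fderiv ℝ f p with hA
  -- Projections of `W` onto the range of `A` and of `P` onto its kernel. The map `F = (pR ∘ f, pK)`
  -- below has bijective derivative at `p`, hence is a local chart.
  obtain ⟨pR, hpR⟩ := (LinearMap.range A.toLinearMap).subtype.exists_leftInverse_of_injective
    (Submodule.ker_subtype _)
  obtain ⟨pK, hpK⟩ := (LinearMap.ker A.toLinearMap).subtype.exists_leftInverse_of_injective
    (Submodule.ker_subtype _)
  let R := LinearMap.range A.toLinearMap
  let K := LinearMap.ker A.toLinearMap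
  let cR : W →L[ℝ] R := LinearMap.toContinuousLinearMap pR
  let cK : P →L[ℝ] K := LinearMap.toContinuousLinearMap pK
  have hcR : ∀ x, cR (A x) = ⟨A x, ⟨x, rfl⟩⟩ := fun x =>
    LinearMap.congr_fun hpR (⟨A x, ⟨x, rfl⟩⟩ : R)
  have hcK : ∀ x (hx : A x = 0), cK x = ⟨x, hx⟩ := fun x hx =>
    LinearMap.congr_fun hpK (⟨x, hx⟩ : K)
  let T : P →L[ℝ] R × K := (cR.comp A).prod cK
  have hTinj : Function.Injective T := by
    rw [injective_iff_map_eq_zero]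
    intro x hx
    have h1 : cR (A x) = 0 := congrArg Prod.fst hx
    have h2 : cK x = 0 := congrArg Prod.snd hx
    rw [hcR] at h1
    have h3 : A x = 0 := congrArg Subtype.val h1
    rw [hcK x h3] at h2
    exact congrArg Subtype.val h2
  have hdim : Module.finrank ℝ P = Module.finrank ℝ (R × K) := by
    rw [Module.finrank_prod]
    exact (LinearMap.finrank_range_add_finrank_ker A.toLinearMap).symm
  let e : P ≃L[ℝ] R × K :=
    (LinearMap.linearEquivOfInjective T.toLinearMap hTinj hdim).toContinuousLinearEquiv
  have he : (e : P →L[ℝ] R × K) = T := by ext x <;> rfl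
  let F : P → R × K := fun x => (cR (f x), cK x)
  have hF : ContDiffAt ℝ ⊤ F p :=
    ((cR.contDiff.comp hf).prodMk cK.contDiff).contDiffAt
  have hF' : HasFDerivAt F (e : P →L[ℝ] R × K) p := by
    rw [he]
    exact (cR.hasFDerivAt.comp p (hdiff p).hasFDerivAt).prodMk cK.hasFDerivAt
  -- Here `⊤ : WithTop ℕ∞` is the analytic level `ω`, so the local inverse and the curve below are
  -- analytic.
  have htop : (⊤ : WithTop ℕ∞) ≠ 0 := by simp
  let g := hF.localInverse hF' htop
  have hg0 : g (F p) = p := hF.localInverse_apply_image hF' htop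
  have hg : ContDiffAt ℝ ⊤ g (F p) := hF.to_localInverse hF' htop
  have hstrict := hF.hasStrictFDerivAt' hF' htop
  have hg' : HasFDerivAt g (e.symm : R × K →L[ℝ] P) (F p) :=
    hstrict.to_localInverse.hasFDerivAt
  have hright : ∀ᶠ y in 𝓝 (F p), F (g y) = y := hstrict.eventually_right_inverse
  let v : R × K := (0, ⟨u, hu⟩)
  have hev : e.symm v = u := by
    rw [ContinuousLinearEquiv.symm_apply_eq]
    have : e u = T u := by rw [← he]; rfl
    rw [this]
    change v = (cR (A u), cK u)
    rw [hcK u hu, hu, map_zero]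
  -- A straight line in the chart: only the kernel coordinate moves, so `pR ∘ f` is constant on its
  -- preimage, the required curve.
  let l : ℝ → R × K := fun t => F p + t • v
  have hl0 : l 0 = F p := by simp [l]
  have hl : ContDiff ℝ ⊤ l := contDiff_const.add (contDiff_id.smul contDiff_const)
  have hl' : HasDerivAt l v 0 := by
    have h := ((hasDerivAt_id (0 : ℝ)).smul_const v).const_add (F p)
    rwa [one_smul] at h
  have hc0 : (g ∘ l) 0 = p := by simp [hl0, hg0]
  have hcan : ContDiffAt ℝ ⊤ (g ∘ l) 0 := by
    refine ContDiffAt.comp 0 ?_ hl.contDiffAt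
    rw [hl0]; exact hg
  have hcana : AnalyticAt ℝ (g ∘ l) 0 := hcan.analyticAt
  have hcderiv : HasDerivAt (g ∘ l) u 0 := by
    have : HasFDerivAt g (e.symm : R × K →L[ℝ] P) (l 0) := by rw [hl0]; exact hg'
    have h := this.comp_hasDerivAt (0 : ℝ) hl'
    rwa [ContinuousLinearEquiv.coe_coe, hev] at h
  refine ⟨g ∘ l, hcana, hc0, hcderiv, ?_⟩
  -- Near `p` the map `pR ∘ f'(r)` keeps rank at least `dim R`, so its kernel has dimension at most
  -- `dim ker A`, which is at most `dim ker f'(r)` by minimality. The two kernels coincide, and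
  -- constancy of `pR ∘ f` along the curve forces constancy of `f`.
  have hkereq : ∀ᶠ r in 𝓝 p, ∀ w, cR (fderiv ℝ f r w) = 0 → fderiv ℝ f r w = 0 := by
    have hcont : ContinuousAt (fun r => cR.comp (fderiv ℝ f r)) p := by
      exact (continuous_const.clm_comp (hf.continuous_fderiv (by simp))).continuousAt
    filter_upwards [hker, eventually_finrank_range_le hcont] with r h1 h2 w hw
    have hle : LinearMap.ker (fderiv ℝ f r).toLinearMap ≤
        LinearMap.ker (cR.comp (fderiv ℝ f r)).toLinearMap := by
      intro x hx
      have hx' : fderiv ℝ f r x = 0 := hx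
      change cR (fderiv ℝ f r x) = 0
      rw [hx', map_zero]
    have hR : Module.finrank ℝ (LinearMap.range (cR.comp (fderiv ℝ f p)).toLinearMap) =
        Module.finrank ℝ R := by
      have : LinearMap.range (cR.comp (fderiv ℝ f p)).toLinearMap = ⊤ := by
        rw [LinearMap.range_eq_top]
        rintro ⟨_, x, rfl⟩
        exact ⟨x, hcR x⟩
      rw [this, finrank_top]
    rw [hR] at h2
    have e1 := LinearMap.finrank_range_add_finrank_ker (cR.comp (fderiv ℝ f r)).toLinearMap
    have e2 := LinearMap.finrank_range_add_finrank_ker A.toLinearMap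
    have h3 : Module.finrank ℝ (LinearMap.ker (cR.comp (fderiv ℝ f r)).toLinearMap) ≤
        Module.finrank ℝ (LinearMap.ker (fderiv ℝ f r).toLinearMap) := by
      change Module.finrank ℝ (LinearMap.range A.toLinearMap) ≤ _ at h2
      change Module.finrank ℝ (LinearMap.ker A.toLinearMap) ≤ _ at h1
      omega
    have heq := Submodule.eq_of_le_of_finrank_le hle h3
    have : w ∈ LinearMap.ker (fderiv ℝ f r).toLinearMap := by
      rw [heq]; exact hw
    exact this
  have htend : Tendsto (g ∘ l) (𝓝 0) (𝓝 p) := by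
    have := hcana.continuousAt.tendsto
    rwa [hc0] at this
  have hltend : Tendsto l (𝓝 0) (𝓝 (F p)) := by
    have := hl.continuous.tendsto 0
    rwa [hl0] at this
  have hconst : ∀ᶠ t in 𝓝 (0 : ℝ), cR (f ((g ∘ l) t)) = cR (f p) := by
    filter_upwards [hltend.eventually hright] with t ht
    have : cR (f (g (l t))) = (l t).1 := congrArg Prod.fst ht
    simpa [l, v, F] using this
  have hderiv0 : ∀ᶠ t in 𝓝 (0 : ℝ), HasDerivAt (fun s => f ((g ∘ l) s)) 0 t := by
    filter_upwards [hconst.eventually_nhds, htend.eventually hkereq,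
      hcana.eventually_analyticAt] with t h1 h2 h3
    have hd := (hdiff ((g ∘ l) t)).hasFDerivAt.comp_hasDerivAt t h3.differentiableAt.hasDerivAt
    have hd2 := cR.hasFDerivAt.comp_hasDerivAt t hd
    have hd3 : HasDerivAt (fun s => cR (f ((g ∘ l) s))) 0 t :=
      (hasDerivAt_const t (cR (f p))).congr_of_eventuallyEq h1
    have hz := h2 _ (hd2.unique hd3)
    rw [hz] at hd
    exact hd
  obtain ⟨ε, hε, hball⟩ := Metric.eventually_nhds_iff_ball.1 hderiv0
  filter_upwards [Metric.ball_mem_nhds (0 : ℝ) hε] with t ht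
  have := (convex_ball (0 : ℝ) ε).is_const_of_fderivWithin_eq_zero (𝕜 := ℝ)
    (f := fun s => f ((g ∘ l) s))
    (fun s hs => (hball s hs).differentiableAt.differentiableWithinAt)
    (fun s hs => by
      rw [fderivWithin_of_isOpen Metric.isOpen_ball hs]
      ext
      simpa using (hball s hs).deriv) ht (Metric.mem_ball_self hε)
  simpa only [hc0] using this

end ConstantRank

/-! ### Equivariant extension of partially defined skew maps. -/

section SkewExtension

variable {L F : Type*} [AddCommGroup L] [Module ℝ L] [NormedAddCommGroup F]
  [InnerProductSpace ℝ F] [FiniteDimensional ℝ F]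

/-- A linear map `a l ↦ b l` that is skew on the range of `a` and commutes with a group of
isometries preserving this range extends to a skew map of the whole space commuting with
the group. -/
theorem exists_skew_extension (a b : L →ₗ[ℝ] F) (S : Subgroup (F ≃ₗᵢ[ℝ] F))
    (hskew : ∀ l, inner ℝ (a l) (b l) = 0) (hker : ∀ l, a l = 0 → b l = 0)
    (hS : ∀ x ∈ S, ∀ l, ∃ l', x (a l) = a l' ∧ x (b l) = b l') :
    ∃ A : F →L[ℝ] F, (∀ v, inner ℝ (A v) v = 0) ∧ (∀ x ∈ S, ∀ v, x (A v) = A (x v)) ∧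
      ∀ l, A (a l) = b l := by
  let U := LinearMap.range a
  obtain ⟨s, hs⟩ := a.rangeRestrict.exists_rightInverse_of_surjective a.range_rangeRestrict
  -- The map `a l ↦ b l`, extended by zero to the orthogonal complement of `U`.
  let B : F →L[ℝ] F := LinearMap.toContinuousLinearMap
    ((b ∘ₗ s) ∘ₗ U.orthogonalProjectionOnto.toLinearMap)
  have hBdef : ∀ v, B v = b (s (U.orthogonalProjectionOnto v)) := fun _ => rfl
  have hbs : ∀ w : U, ∀ l, a l = w → b (s w) = b l := by
    intro w l hl
    have h1 : a (s w) = w := congrArg Subtype.val (LinearMap.congr_fun hs w)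
    have : b (s w - l) = 0 := hker _ (by rw [map_sub, h1, hl, sub_self])
    rwa [map_sub, sub_eq_zero] at this
  let Q : F →L[ℝ] F := U.starProjection
  have hQmem : ∀ v, Q v ∈ U := fun v => U.starProjection_apply_mem v
  have hBP : ∀ v l, Q v = a l → B v = b l := fun v l h => hbs _ l h.symm
  have hQa : ∀ l, Q (a l) = a l := fun l =>
    Submodule.starProjection_eq_self_iff.2 ⟨l, rfl⟩
  have hBa : ∀ l, B (a l) = b l := fun l => hBP _ l (hQa l)
  have hBQ : ∀ v, B (Q v) = B v := by
    intro v
    obtain ⟨l, hl⟩ := hQmem v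
    rw [hBP v l hl.symm, ← hl, hBa]
  have hQS : ∀ x ∈ S, ∀ v, x (Q v) = Q (x v) := by
    intro x hx v
    symm
    apply Submodule.eq_starProjection_of_mem_of_inner_eq_zero
    · obtain ⟨l, hl⟩ := hQmem v
      obtain ⟨l', hl', -⟩ := hS x hx l
      exact ⟨l', by rw [← hl', hl]⟩
    · rintro _ ⟨l, rfl⟩
      obtain ⟨l', hl', -⟩ := hS x⁻¹ (S.inv_mem hx) l
      have h1 : a l = x (a l') := by
        rw [← hl']; exact (x.apply_symm_apply _).symm
      rw [h1, ← map_sub, x.inner_map_map]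
      exact Submodule.starProjection_inner_eq_zero _ _ ⟨l', rfl⟩
  have hBS : ∀ x ∈ S, ∀ v, x (B v) = B (x v) := by
    intro x hx v
    obtain ⟨l, hl⟩ := hQmem v
    obtain ⟨l', h1, h2⟩ := hS x hx l
    rw [hBP v l hl.symm, h2, hBP (x v) l']
    rw [← hQS x hx, ← hl, h1]
  have hadjS : ∀ x ∈ S, ∀ v, x (B.adjoint v) = B.adjoint (x v) := by
    intro x hx v
    refine ext_inner_right ℝ fun w => ?_
    rw [ContinuousLinearMap.adjoint_inner_left]
    have h1 : w = x (x⁻¹ w) := (x.apply_symm_apply w).symm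
    have h2 := hBS x hx (x⁻¹ w)
    rw [h1, x.inner_map_map, ContinuousLinearMap.adjoint_inner_left, ← h2, x.inner_map_map]
  have hBskew : ∀ v, inner ℝ (B v) (Q v) = 0 := by
    intro v
    obtain ⟨l, hl⟩ := hQmem v
    rw [hBP v l hl.symm, ← hl, real_inner_comm]
    exact hskew l
  -- The correction vanishes on `U`, where `Q` is the identity, and it makes the map skew: pairing
  -- its value at `v` with `v` leaves `⟪B v, v⟫ - ⟪B v, v - Q v⟫ = ⟪B v, Q v⟫ = 0`.
  refine ⟨B - B.adjoint ∘L (ContinuousLinearMap.id ℝ F - Q), fun v => ?_, fun x hx v => ?_,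
    fun l => ?_⟩
  · have e : (B - B.adjoint ∘L (ContinuousLinearMap.id ℝ F - Q)) v =
        B v - B.adjoint (v - Q v) := rfl
    rw [e, inner_sub_left, ContinuousLinearMap.adjoint_inner_left, real_inner_comm (B v) (v - Q v),
      inner_sub_right, hBskew, sub_zero, sub_self]
  · change x (B v - B.adjoint (v - Q v)) = B (x v) - B.adjoint (x v - Q (x v))
    rw [map_sub, hBS x hx, hadjS x hx, map_sub, hQS x hx]
  · change B (a l) - B.adjoint (a l - Q (a l)) = b l
    rw [hQa, sub_self, map_zero, sub_zero, hBa]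

end SkewExtension

/-! ### Symmetric infinitesimal flexes and infinitesimal rigid motions. -/

section InfinitesimalFlex

variable {V : Type*} {m : ℕ} {G : SimpleGraph V} {S : Subgroup (O m)} {Φ : S → (G ≃g G)}

theorem edgeFunction_eq_iff {p r : V → E m} :
    edgeFunction G p = edgeFunction G r ↔ ∀ i j, G.Adj i j → ‖p i - p j‖ ^ 2 = ‖r i - r j‖ ^ 2 := by
  constructor
  · intro h i j hij
    exact congrFun h ⟨s(i, j), hij⟩
  · intro h
    funext ⟨e, he⟩
    induction e using Sym2.ind with
    | _ i j => exact h i j he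

theorem edgeFunction_top_eq_iff {p r : V → E m} :
    edgeFunction (⊤ : SimpleGraph V) p = edgeFunction ⊤ r ↔
      ∀ i j, ‖p i - p j‖ ^ 2 = ‖r i - r j‖ ^ 2 := by
  rw [edgeFunction_eq_iff]
  refine ⟨fun h i j => ?_, fun h i j _ => h i j⟩
  by_cases hij : i = j
  · simp [hij]
  · exact h i j hij

/-- The `S`-symmetric infinitesimal flexes of `(G, r)`. -/
def infFlex (r : symConfig G S Φ) : Submodule ℝ (symConfig G S Φ) where
  carrier := {u | ∀ i j, G.Adj i j → inner ℝ (r.1 i - r.1 j) (u.1 i - u.1 j) = 0}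
  add_mem' {u v} hu hv i j hij := by
    have : (u + v).1 i - (u + v).1 j = (u.1 i - u.1 j) + (v.1 i - v.1 j) := by
      simp only [Submodule.coe_add, Pi.add_apply]; abel
    rw [this, inner_add_right, hu i j hij, hv i j hij, add_zero]
  zero_mem' i j _ := by simp
  smul_mem' c u hu i j hij := by
    have : (c • u).1 i - (c • u).1 j = c • (u.1 i - u.1 j) := by
      simp [smul_sub]
    rw [this, inner_smul_right, hu i j hij, mul_zero]

theorem mem_infFlex {r u : symConfig G S Φ} :
    u ∈ infFlex r ↔ ∀ i j, G.Adj i j → inner ℝ (r.1 i - r.1 j) (u.1 i - u.1 j) = 0 :=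
  Iff.rfl

/-- The infinitesimal rigid motions `v ↦ A v + b` commuting with `S`. -/
def symMotion (S : Subgroup (O m)) : Submodule ℝ ((E m →L[ℝ] E m) × E m) where
  carrier := {M | (∀ v, inner ℝ (M.1 v) v = 0) ∧
    ∀ x ∈ S, (∀ v, x (M.1 v) = M.1 (x v)) ∧ x M.2 = M.2}
  add_mem' {M N} hM hN := by
    refine ⟨fun v => ?_, fun x hx => ⟨fun v => ?_, ?_⟩⟩
    · simp [inner_add_left, hM.1 v, hN.1 v]
    · simp [(hM.2 x hx).1 v, (hN.2 x hx).1 v]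
    · simp [(hM.2 x hx).2, (hN.2 x hx).2]
  zero_mem' := ⟨fun v => by simp, fun x hx => ⟨fun v => by simp, by simp⟩⟩
  smul_mem' c M hM := by
    refine ⟨fun v => ?_, fun x hx => ⟨fun v => ?_, ?_⟩⟩
    · simp [inner_smul_left, hM.1 v]
    · simp [(hM.2 x hx).1 v]
    · simp [(hM.2 x hx).2]

/-- The velocities `i ↦ A (r i) + b` of the joints under an infinitesimal rigid motion. -/
def motionVelocity (r : symConfig G S Φ) : symMotion S →ₗ[ℝ] symConfig G S Φ where
  toFun M := ⟨fun i => M.1.1 (r.1 i) + M.1.2, fun x i => by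
    rw [map_add, (M.2.2 x x.2).1, (M.2.2 x x.2).2, r.2 x i]⟩
  map_add' M N := by
    ext1; funext i
    change (M.1.1 + N.1.1) (r.1 i) + (M.1.2 + N.1.2) =
      (M.1.1 (r.1 i) + M.1.2) + (N.1.1 (r.1 i) + N.1.2)
    rw [add_apply]; abel
  map_smul' c M := by
    ext1; funext i
    change (c • M.1.1) (r.1 i) + c • M.1.2 = c • (M.1.1 (r.1 i) + M.1.2)
    rw [smul_apply, smul_add]

theorem mem_range_motionVelocity {r u : symConfig G S Φ} :
    u ∈ LinearMap.range (motionVelocity r) ↔ ∃ M ∈ symMotion S, ∀ i, u.1 i = M.1 (r.1 i) + M.2 := by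
  constructor
  · rintro ⟨M, rfl⟩
    exact ⟨M.1, M.2, fun i => rfl⟩
  · rintro ⟨M, hM, h⟩
    exact ⟨⟨M, hM⟩, Subtype.ext (funext fun i => (h i).symm)⟩

theorem inner_motionVelocity (r : symConfig G S Φ) (M : symMotion S) (i j : V) :
    inner ℝ (r.1 i - r.1 j) ((motionVelocity r M).1 i - (motionVelocity r M).1 j) = 0 := by
  have : (motionVelocity r M).1 i - (motionVelocity r M).1 j = M.1.1 (r.1 i - r.1 j) := by
    change (M.1.1 (r.1 i) + M.1.2) - (M.1.1 (r.1 j) + M.1.2) = _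
    rw [map_sub]; abel
  rw [this, real_inner_comm]
  exact M.2.1 _

theorem range_motionVelocity_le (r : symConfig G S Φ) :
    LinearMap.range (motionVelocity r) ≤ infFlex r := by
  rintro _ ⟨M, rfl⟩ i j _
  exact inner_motionVelocity r M i j

theorem continuous_motionVelocity (M : symMotion S) :
    Continuous fun r : symConfig G S Φ => motionVelocity r M := by
  rw [continuous_induced_rng]
  refine continuous_pi fun i => ?_
  exact (M.1.1.continuous.comp ((continuous_apply i).comp continuous_subtype_val)).add
    continuous_const

variable [Fintype V]

open Classical in
theorem contDiff_edgeFunction :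
    ContDiff ℝ ⊤ (fun r : symConfig G S Φ => edgeFunction G (r : V → E m)) := by
  rw [contDiff_pi]
  rintro ⟨e, he⟩
  induction e using Sym2.ind with
  | _ i j =>
    have h : ∀ k, ContDiff ℝ ⊤ (fun r : symConfig G S Φ => r.1 k) := fun k =>
      ((ContinuousLinearMap.proj (R := ℝ) (φ := fun _ : V => E m) k).comp
        (symConfig G S Φ).subtypeL).contDiff
    exact ((h i).sub (h j)).norm_sq ℝ

-- Each edge component is the squared norm of a linear function of `r`; its derivative is twice the
-- inner product occurring in `infFlex`.
open Classical in
theorem ker_fderiv_edgeFunction (r : symConfig G S Φ) :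
    LinearMap.ker (fderiv ℝ (fun r : symConfig G S Φ => edgeFunction G (r : V → E m)) r).toLinearMap
      = infFlex r := by
  have hd := (contDiff_edgeFunction (G := G) (S := S) (Φ := Φ)).differentiable (by simp) r
  have key : ∀ u : symConfig G S Φ, ∀ i j, (hij : G.Adj i j) →
      fderiv ℝ (fun r : symConfig G S Φ => edgeFunction G (r : V → E m)) r u ⟨s(i, j), hij⟩ =
        2 * inner ℝ (r.1 i - r.1 j) (u.1 i - u.1 j) := by
    intro u i j hij
    have h1 := hasFDerivAt_pi'.1 hd.hasFDerivAt ⟨s(i, j), hij⟩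
    let l : symConfig G S Φ →L[ℝ] E m :=
      ((ContinuousLinearMap.proj (R := ℝ) (φ := fun _ : V => E m) i) -
        ContinuousLinearMap.proj (R := ℝ) (φ := fun _ : V => E m) j).comp (symConfig G S Φ).subtypeL
    have h2 := (l.hasFDerivAt (x := r)).norm_sq
    have h3 := congrArg (fun A => A u) (h1.unique h2)
    rw [ofNat_smul_eq_nsmul, smul_apply, nsmul_eq_mul] at h3
    exact h3
  ext u
  rw [mem_infFlex]
  constructor
  · intro hu i j hij
    have h0 : fderiv ℝ (fun r : symConfig G S Φ => edgeFunction G (r : V → E m)) r u = 0 := hu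
    have := key u i j hij
    rw [h0] at this
    simpa using this.symm
  · intro hu
    change fderiv ℝ (fun r : symConfig G S Φ => edgeFunction G (r : V → E m)) r u = 0
    funext ⟨e, he⟩
    induction e using Sym2.ind with
    | _ i j => rw [key u i j he, hu i j he, mul_zero]; rfl

/-- Rank-nullity. It converts maximal rank, as in `IsSRegularPoint`, into minimal dimension of the
space of infinitesimal flexes. -/
theorem symRank_add_finrank_infFlex (r : symConfig G S Φ) :
    symRank G S Φ r + Module.finrank ℝ (infFlex r) = Module.finrank ℝ (symConfig G S Φ) := by
  classical
  rw [← ker_fderiv_edgeFunction]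
  exact LinearMap.finrank_range_add_finrank_ker _

/-- Near `p` the space of velocities of rigid motions has at least the dimension it has at `p`. -/
theorem eventually_finrank_motionVelocity_le (p : symConfig G S Φ) :
    ∀ᶠ r in 𝓝 p, Module.finrank ℝ (LinearMap.range (motionVelocity p)) ≤
      Module.finrank ℝ (LinearMap.range (motionVelocity r)) := by
  have h := eventually_finrank_range_le_of_linearMap (X := symMotion S) (T := symConfig G S Φ)
    (W := symConfig G S Φ) (F := motionVelocity) continuous_motionVelocity p
  exact h

/-- The rank of the derivative cannot drop near `p`, so its kernel cannot grow. -/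
theorem eventually_finrank_infFlex_le (p : symConfig G S Φ) :
    ∀ᶠ r in 𝓝 p, Module.finrank ℝ (infFlex r) ≤ Module.finrank ℝ (infFlex p) := by
  classical
  have hcont := (contDiff_edgeFunction (G := G) (S := S) (Φ := Φ)).continuous_fderiv (by simp)
  filter_upwards [eventually_finrank_range_le (hcont.continuousAt (x := p))] with r hr
  have h1 := symRank_add_finrank_infFlex r
  have h2 := symRank_add_finrank_infFlex p
  change symRank G S Φ p ≤ symRank G S Φ r at hr
  omega

/-- If every infinitesimal flex at `p` is a rigid motion, the same is true near `p`. -/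
theorem eventually_infFlex_le {p : symConfig G S Φ}
    (h : infFlex p ≤ LinearMap.range (motionVelocity p)) :
    ∀ᶠ r in 𝓝 p, infFlex r ≤ LinearMap.range (motionVelocity r) := by
  filter_upwards [eventually_finrank_motionVelocity_le p, eventually_finrank_infFlex_le p]
    with r h1 h2
  -- The dimensions are squeezed: flexes at `r` ≤ flexes at `p` ≤ rigid motions at `p` ≤ rigid
  -- motions at `r`, while rigid motions at `r` are among the flexes at `r`.
  have h3 := Submodule.finrank_mono h
  exact (Submodule.eq_of_le_of_finrank_le (range_motionVelocity_le r)
    (h2.trans (h3.trans h1))).ge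

/-- The initial velocity of a curve of congruent configurations is that of a rigid motion. -/
theorem mem_range_motionVelocity_of_congruent {p u : symConfig G S Φ} {y : ℝ → V → E m}
    (h0 : y 0 = p) (hy : HasDerivAt y u 0)
    (hc : ∀ᶠ t in 𝓝 (0 : ℝ), ∀ i j, ‖y t i - y t j‖ ^ 2 = ‖p.1 i - p.1 j‖ ^ 2) :
    u ∈ LinearMap.range (motionVelocity p) := by
  classical
  -- Coefficient vectors of sum zero. The norm of such a combination of the joints depends only on
  -- their pairwise distances, so it is constant along `y`; differentiating gives skewness.
  let Λ : Submodule ℝ (V → ℝ) := LinearMap.ker (∑ i, LinearMap.proj (R := ℝ) (φ := fun _ : V => ℝ) i)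
  have hΛ : ∀ l : V → ℝ, l ∈ Λ ↔ ∑ i, l i = 0 := by
    intro l; simp [Λ]
  let comb : (V → E m) → Λ →ₗ[ℝ] E m := fun r => (Fintype.linearCombination ℝ r) ∘ₗ Λ.subtype
  have hcomb : ∀ r l, comb r l = ∑ i, l.1 i • r i := fun r l => rfl
  have hnorm : ∀ l : Λ, ∀ᶠ t in 𝓝 (0 : ℝ), ‖comb (y t) l‖ ^ 2 = ‖comb p l‖ ^ 2 := by
    intro l
    filter_upwards [hc] with t ht
    have hl := (hΛ _).1 l.2
    rw [← real_inner_self_eq_norm_sq, ← real_inner_self_eq_norm_sq, hcomb, hcomb,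
      inner_sum_smul_sum_smul_of_sum_eq_zero _ hl _ hl,
      inner_sum_smul_sum_smul_of_sum_eq_zero _ hl _ hl]
    simp only [← sq, ht]
  have hderiv : ∀ l : Λ, HasDerivAt (fun t => comb (y t) l) (comb u l) 0 := by
    intro l
    simp only [hcomb]
    exact HasDerivAt.fun_sum fun i _ => (hasDerivAt_pi.1 hy i).const_smul (l.1 i)
  have hskew : ∀ l, inner ℝ (comb p l) (comb u l) = 0 := by
    intro l
    have h1 := (hderiv l).norm_sq
    have h2 := (hasDerivAt_const (0 : ℝ) (‖comb p l‖ ^ 2)).congr_of_eventuallyEq (hnorm l)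
    have h3 := h1.unique h2
    rw [h0] at h3
    simpa using h3
  -- A combination vanishing at `p` has norm zero along the whole congruent curve, so its velocity
  -- vanishes too; this makes `comb p l ↦ comb u l` well defined.
  have hker : ∀ l, comb p l = 0 → comb u l = 0 := by
    intro l hl
    refine (hderiv l).unique ((hasDerivAt_const (0 : ℝ) (0 : E m)).congr_of_eventuallyEq ?_)
    filter_upwards [hnorm l] with t ht
    rw [hl] at ht
    simpa using ht
  have hS : ∀ x ∈ S, ∀ l : Λ, ∃ l' : Λ, x (comb p l) = comb p l' ∧ x (comb u l) = comb u l' := by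
    -- A symmetry acts on combinations by permuting the coefficients, in the same way for `p` and
    -- `u`.
    intro x hx l
    let σ := (Φ ⟨x, hx⟩).toEquiv
    have hmem : (fun i => l.1 (σ.symm i)) ∈ Λ := by
      rw [hΛ, Equiv.sum_comp σ.symm l.1]
      exact (hΛ _).1 l.2
    have key : ∀ r : symConfig G S Φ, x (comb r l) = comb r ⟨_, hmem⟩ := by
      intro r
      rw [hcomb, hcomb, map_sum, ← Equiv.sum_comp σ (fun i => l.1 (σ.symm i) • r.1 i)]
      refine Finset.sum_congr rfl fun i _ => ?_
      rw [map_smul, σ.symm_apply_apply]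
      exact congrArg (l.1 i • ·) (r.2 ⟨x, hx⟩ i)
    exact ⟨⟨_, hmem⟩, key p, key u⟩
  obtain ⟨A, hA, hAS, hAu⟩ := exists_skew_extension (comb p) (comb u) S hskew hker hS
  have hdiff : ∀ i j, u.1 i - u.1 j = A (p.1 i - p.1 j) := by
    intro i j
    have hmem : (Pi.single i 1 - Pi.single j 1 : V → ℝ) ∈ Λ := by
      rw [hΛ]; simp
    have := hAu ⟨_, hmem⟩
    simpa [hcomb, sub_smul, Pi.single_apply] using this.symm
  rw [mem_range_motionVelocity]
  rcases isEmpty_or_nonempty V with hV | ⟨⟨o⟩⟩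
  · exact ⟨0, (symMotion S).zero_mem, fun i => hV.elim i⟩
  · have hb : ∀ i, u.1 i - A (p.1 i) = u.1 o - A (p.1 o) := by
      intro i
      have := hdiff i o
      rw [map_sub, sub_eq_sub_iff_add_eq_add] at this
      rw [sub_eq_sub_iff_add_eq_add, this, add_comm]
    -- The translation part `u i - A (p i)` does not depend on `i`. A symmetry carries its
    -- expression at `o` to the one at another joint, hence fixes it.
    refine ⟨(A, u.1 o - A (p.1 o)), ⟨hA, fun x hx => ⟨hAS x hx, ?_⟩⟩, fun i => ?_⟩
    · change x (u.1 o - A (p.1 o)) = u.1 o - A (p.1 o)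
      rw [map_sub, hAS x hx, ← hb (Φ ⟨x, hx⟩ o)]
      have h1 := u.2 ⟨x, hx⟩ o
      have h2 := p.2 ⟨x, hx⟩ o
      rw [← h1, ← h2]
    · change u.1 i = A (p.1 i) + (u.1 o - A (p.1 o))
      rw [← hb i]; abel

end InfinitesimalFlex

/-! ### From finite flexes to infinitesimal flexes and back. -/

section FiniteFlex

variable {V : Type*} {m : ℕ} {G : SimpleGraph V} {S : Subgroup (O m)}
  {Φ : S → (G ≃g G)}

/-- The right velocity of a path of symmetric configurations is symmetric. -/
theorem velocity_mem_symConfig {x : ℝ → V → E m} {x' : V → E m} {t : ℝ}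
    (hx : ∀ᶠ s in 𝓝[≥] t, x s ∈ symConfig G S Φ) (hd : HasDerivWithinAt x x' (Set.Ici t) t) :
    x' ∈ symConfig G S Φ := by
  intro g i
  have h1 : HasDerivWithinAt (fun s => (g : O m) (x s i)) ((g : O m) (x' i)) (Set.Ici t) t :=
    (g : O m).toContinuousLinearEquiv.toContinuousLinearMap.hasFDerivAt.comp_hasDerivWithinAt t
      (hasDerivWithinAt_pi.1 hd i)
  have h2 : HasDerivWithinAt (fun s => (g : O m) (x s i)) (x' (Φ g i)) (Set.Ici t) t := by
    refine (hasDerivWithinAt_pi.1 hd (Φ g i)).congr_of_eventuallyEq ?_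
      (hx.self_of_nhdsWithin Set.self_mem_Ici g i)
    filter_upwards [hx] with s hs using hs g i
  exact (uniqueDiffWithinAt_Ici t).eq_deriv _ h1 h2

/-- Along a path with constant edge lengths the right velocity is an infinitesimal flex. -/
theorem inner_velocity_eq_zero {x : ℝ → V → E m} {x' : V → E m} {t : ℝ} {i j : V} {c : ℝ}
    (hx : ∀ᶠ s in 𝓝[≥] t, ‖x s i - x s j‖ ^ 2 = c) (hd : HasDerivWithinAt x x' (Set.Ici t) t) :
    inner ℝ (x t i - x t j) (x' i - x' j) = 0 := by
  have h1 := ((hasDerivWithinAt_pi.1 hd i).sub (hasDerivWithinAt_pi.1 hd j)).norm_sq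
  have h2 := (hasDerivWithinAt_const t (Set.Ici t) c).congr_of_eventuallyEq hx
    (hx.self_of_nhdsWithin Set.self_mem_Ici)
  have h3 := (uniqueDiffWithinAt_Ici t).eq_deriv _ h1 h2
  simpa using h3

variable [Fintype V]

/-- A framework with a symmetric finite flex has a symmetric infinitesimal flex which is not a
rigid motion. -/
theorem not_infFlex_le_of_hasSymFlex {p : symConfig G S Φ} (hp : Function.Injective p.1)
    (h : HasSymFlex G S p.1) : ¬ infFlex p ≤ LinearMap.range (motionVelocity p) := by
  intro hle
  obtain ⟨Ψ, hΨ, x, hxan, hx0, hx, hxne⟩ := h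
  obtain rfl := type_unique hp hΨ p.2
  have hnear : ∀ᶠ r in 𝓝[(symConfig G S Ψ : Set (V → E m))] p.1, ∀ hr : r ∈ symConfig G S Ψ,
      infFlex ⟨r, hr⟩ ≤ LinearMap.range (motionVelocity ⟨r, hr⟩) := by
    refine (eventually_nhds_subtype_iff (symConfig G S Ψ : Set (V → E m)) p
      (fun r => ∀ hr : r ∈ symConfig G S Ψ,
      infFlex ⟨r, hr⟩ ≤ LinearMap.range (motionVelocity ⟨r, hr⟩))).1 ?_
    filter_upwards [eventually_infFlex_le hle] with r hr _ using hr
  have h01 : (0 : ℝ) ∈ Set.Icc (0 : ℝ) 1 := ⟨le_rfl, zero_le_one⟩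
  -- The flex conditions hold only on `[0,1]`, so right derivatives are used; each `t < 1` has a
  -- right neighbourhood inside `[0,1]`.
  have hev : ∀ t ∈ Set.Ico (0 : ℝ) 1, ∀ᶠ s in 𝓝[≥] t, s ∈ Set.Icc (0 : ℝ) 1 := by
    intro t ht
    filter_upwards [Ico_mem_nhdsGE ht.2] with s hs using ⟨ht.1.trans hs.1, hs.2.le⟩
  have htend : Tendsto x (𝓝[≥] 0) (𝓝[(symConfig G S Ψ : Set (V → E m))] p.1) := by
    refine tendsto_nhdsWithin_iff.2 ⟨?_, ?_⟩
    · have := (hxan 0 h01).continuousAt.tendsto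
      rw [hx0] at this
      exact this.mono_left nhdsWithin_le_nhds
    · filter_upwards [hev 0 ⟨le_rfl, zero_lt_one⟩] with s hs using (hx s hs).2.1
  obtain ⟨δ, hδ0, hδ⟩ := mem_nhdsGE_iff_exists_Icc_subset.1 (htend.eventually hnear)
  have hδ0 : 0 < δ := hδ0
  let T := min δ 1
  have hT0 : 0 < T := lt_min hδ0 zero_lt_one
  have hTmem : T ∈ Set.Ioc (0 : ℝ) 1 := ⟨hT0, min_le_right _ _⟩
  -- Up to time `T` every infinitesimal flex is rigid, so all squared distances have right
  -- derivative zero and `x T` is congruent to `p`.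
  refine hxne T hTmem (edgeFunction_top_eq_iff.2 fun i j => ?_)
  rw [← hx0]
  have hdiff : ∀ t ∈ Set.Icc (0 : ℝ) 1, ∀ i, DifferentiableAt ℝ (fun s => x s i) t := fun t ht =>
    differentiableAt_pi.1 (hxan t ht).differentiableAt
  refine constant_of_has_deriv_right_zero (f := fun t => ‖x t i - x t j‖ ^ 2) (a := 0) (b := T)
    ?_ ?_ T ⟨hT0.le, le_rfl⟩
  · intro t ht
    have ht1 : t ∈ Set.Icc (0 : ℝ) 1 := ⟨ht.1, ht.2.trans hTmem.2⟩
    exact (((hdiff t ht1 i).sub (hdiff t ht1 j)).norm_sq ℝ).continuousAt.continuousWithinAt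
  · intro t ht
    have ht1 : t ∈ Set.Ico (0 : ℝ) 1 := ⟨ht.1, ht.2.trans_le hTmem.2⟩
    have ht2 : t ∈ Set.Icc (0 : ℝ) 1 := ⟨ht1.1, ht1.2.le⟩
    have hd : HasDerivWithinAt x (deriv x t) (Set.Ici t) t :=
      (hxan t ht2).differentiableAt.hasDerivAt.hasDerivWithinAt
    have hmem : deriv x t ∈ symConfig G S Ψ :=
      velocity_mem_symConfig ((hev t ht1).mono fun s hs => (hx s hs).2.1) hd
    have hflex : (⟨_, hmem⟩ : symConfig G S Ψ) ∈ infFlex ⟨x t, (hx t ht2).2.1⟩ := by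
      intro k l hkl
      refine inner_velocity_eq_zero (c := ‖p.1 k - p.1 l‖ ^ 2) ?_ hd
      filter_upwards [hev t ht1] with s hs
      exact edgeFunction_eq_iff.1 (hx s hs).2.2 k l hkl
    obtain ⟨M, hM⟩ := hδ ⟨ht.1, ht.2.le.trans (min_le_left _ _)⟩ _ hflex
    have hz := inner_motionVelocity ⟨x t, (hx t ht2).2.1⟩ M i j
    rw [hM] at hz
    have h1 := ((hasDerivWithinAt_pi.1 hd i).sub (hasDerivWithinAt_pi.1 hd j)).norm_sq
    have hz' : inner ℝ (x t i - x t j) (deriv x t i - deriv x t j) = 0 := hz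
    have h2 : (2 : ℝ) * inner ℝ ((fun s => x s i) t - (fun s => x s j) t)
        (deriv x t i - deriv x t j) = 0 := by rw [hz', mul_zero]
    rw [← h2]
    exact h1

/-- If the dimension of the space of symmetric infinitesimal flexes is locally minimal at `p`, an
infinitesimal flex which is not a rigid motion yields a finite flex. -/
theorem hasSymFlex_of_not_infFlex_le {p : symConfig G S Φ}
    (hmin : ∀ᶠ r in 𝓝 p, Module.finrank ℝ (infFlex p) ≤ Module.finrank ℝ (infFlex r))
    (h : ¬ infFlex p ≤ LinearMap.range (motionVelocity p)) : HasSymFlex G S p.1 := by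
  classical
  obtain ⟨u, hu, hutriv⟩ := Set.not_subset.1 h
  obtain ⟨c, hcan, hc0, hcd, hcf⟩ := exists_analytic_curve_in_fibre
    (contDiff_edgeFunction (G := G) (S := S) (Φ := Φ)) (p := p) (u := u)
    (by
      filter_upwards [hmin] with r hr
      rw [← ker_fderiv_edgeFunction, ← ker_fderiv_edgeFunction] at hr
      exact hr)
    (by
      have : u ∈ infFlex p := hu
      rw [← ker_fderiv_edgeFunction] at this
      exact this)
  let ι := (symConfig G S Φ).subtypeL
  let y : ℝ → V → E m := fun t => c t
  have hyan : AnalyticAt ℝ y 0 := (ι.analyticAt _).comp hcan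
  have hyd : HasDerivAt y u 0 := ι.hasFDerivAt.comp_hasDerivAt 0 hcd
  have hy0 : y 0 = p := congrArg Subtype.val hc0
  have hK : AnalyticAt ℝ (fun t => edgeFunction (⊤ : SimpleGraph V) (y t) -
      edgeFunction (⊤ : SimpleGraph V) p.1) 0 := by
    refine AnalyticAt.sub ?_ analyticAt_const
    refine AnalyticAt.pi ?_
    rintro ⟨e, he⟩
    induction e using Sym2.ind with
    | _ i j =>
      have hi : ∀ k, AnalyticAt ℝ (fun t => y t k) 0 := fun k =>
        ((ContinuousLinearMap.proj (R := ℝ) (φ := fun _ : V => E m) k).analyticAt _).comp hyan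
      have h2 := ((hi i).sub (hi j)).contDiffAt (n := ⊤)
      exact (h2.norm_sq ℝ).analyticAt
  -- Isolated zeros: if the analytic curve is not congruent to `p` for all small times, it is
  -- congruent to `p` at no small nonzero time.
  rcases hK.eventually_eq_zero_or_eventually_ne_zero with hzero | hne
  · refine absurd (mem_range_motionVelocity_of_congruent hy0 hyd ?_) hutriv
    filter_upwards [hzero] with t ht
    exact edgeFunction_top_eq_iff.1 (sub_eq_zero.1 ht)
  · rw [eventually_nhdsWithin_iff] at hne
    obtain ⟨ε, hε, hball⟩ := Metric.eventually_nhds_iff_ball.1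
      (hne.and (hcf.and hyan.eventually_analyticAt))
    -- Rescaling time by `ε / 2` puts all of the closed interval `[0,1]` inside the open ball.
    have hmem : ∀ t ∈ Set.Icc (0 : ℝ) 1, ε / 2 * t ∈ Metric.ball (0 : ℝ) ε := by
      intro t ht
      rw [mem_ball_zero_iff, Real.norm_eq_abs, abs_of_nonneg (mul_nonneg (by linarith) ht.1)]
      nlinarith [ht.2]
    refine ⟨Φ, p.2, fun t => y (ε / 2 * t), fun t ht => ?_, by simp [hy0], fun t ht => ?_,
      fun t ht => ?_⟩
    · exact AnalyticAt.comp (g := y) (f := fun t => ε / 2 * t) (hball _ (hmem t ht)).2.2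
        (analyticAt_const.mul analyticAt_id)
    · exact ⟨Set.mem_univ _, (c _).2, (hball _ (hmem t ht)).2.1⟩
    · have hne0 : ε / 2 * t ≠ 0 := mul_ne_zero (by positivity) ht.1.ne'
      exact sub_ne_zero.1 ((hball _ (hmem t ⟨ht.1.le, ht.2⟩)).1 hne0)

end FiniteFlex

/-! ### Coordinates on `E (d + 1)` and the action of `S^*`. -/

section Coordinates

variable {d : ℕ}

theorem initPt_add (v w : E (d + 1)) : initPt (v + w) = initPt v + initPt w := by
  ext k; simp [initPt]

theorem initPt_smul (c : ℝ) (w : E (d + 1)) : initPt (c • w) = c • initPt w := by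
  ext k; simp [initPt]

theorem snocPt_add (v w : E d) (a b : ℝ) : snocPt (v + w) (a + b) = snocPt v a + snocPt w b := by
  ext k
  refine Fin.lastCases ?_ (fun k => ?_) k <;> simp [snocPt]

theorem snocPt_smul (c : ℝ) (v : E d) (a : ℝ) : snocPt (c • v) (c * a) = c • snocPt v a := by
  ext k
  refine Fin.lastCases ?_ (fun k => ?_) k <;> simp [snocPt]

theorem inner_snocPt (v w : E d) (a b : ℝ) :
    inner ℝ (snocPt v a) (snocPt w b) = inner ℝ v w + a * b := by
  simp [PiLp.inner_apply, Fin.sum_univ_castSucc, snocPt, mul_comm]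

theorem starElem_apply (x : O d) (w : E (d + 1)) :
    starElem x w = snocPt (x (initPt w)) (w (Fin.last d)) := rfl

theorem starElem_snocPt (x : O d) (v : E d) (c : ℝ) :
    starElem x (snocPt v c) = snocPt (x v) c := by
  rw [starElem_apply, initPt_snocPt, snocPt_last]

theorem starElem_last (x : O d) (w : E (d + 1)) :
    (starElem x w) (Fin.last d) = w (Fin.last d) := snocPt_last _ _

theorem initPt_starElem (x : O d) (w : E (d + 1)) : initPt (starElem x w) = x (initPt w) :=
  initPt_snocPt _ _

theorem proj_starElem (x : O d) (w : E (d + 1)) : proj (starElem x w) = x (proj w) := by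
  rw [proj, proj, starElem_last, initPt_starElem, map_smul]

theorem smul_snocPt_proj {w : E (d + 1)} (hw : w (Fin.last d) ≠ 0) :
    w (Fin.last d) • snocPt (proj w) 1 = w := by
  rw [← snocPt_smul, mul_one, proj, smul_inv_smul₀ hw, snocPt_initPt]

theorem starElem_mem {S : Subgroup (O d)} (x : S) : starElem (x : O d) ∈ starGroup S :=
  ⟨x, x.2, rfl⟩

theorem forall_mem_starGroup {S : Subgroup (O d)} {P : O (d + 1) → Prop} :
    (∀ y ∈ starGroup S, P y) ↔ ∀ x ∈ S, P (starElem x) := by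
  constructor
  · exact fun h x hx => h _ (starElem_mem ⟨x, hx⟩)
  · rintro h _ ⟨x, hx, rfl⟩
    exact h x hx

end Coordinates

/-! ### Infinitesimal flexes of a cone and of its central projection. -/

section ConeType

variable {V : Type*} {d : ℕ} {G : SimpleGraph V} {S : Subgroup (O d)} {Φ : S → (G ≃g G)}
  {Ψ : starGroup S → (coneGraph G ≃g coneGraph G)}

/-- The type `Ψ` of cone frameworks fixes the cone vertex and acts on the base as `Φ`. -/
def IsConeType (Φ : S → (G ≃g G)) (Ψ : starGroup S → (coneGraph G ≃g coneGraph G)) : Prop :=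
  ∀ x : S, Ψ ⟨starElem x, starElem_mem x⟩ none = none ∧
    ∀ i, Ψ ⟨starElem x, starElem_mem x⟩ (some i) = some (Φ x i)

theorem mem_symConfig_cone (hC : IsConeType Φ Ψ) {w : Option V → E (d + 1)} :
    w ∈ symConfig (coneGraph G) (starGroup S) Ψ ↔ ∀ x : S, starElem x (w none) = w none ∧
      ∀ i, starElem x (w (some i)) = w (some (Φ x i)) := by
  constructor
  · intro h x
    have h' := h ⟨starElem x, starElem_mem x⟩
    refine ⟨?_, fun i => ?_⟩
    · have := h' none
      rwa [(hC x).1] at this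
    · have := h' (some i)
      rwa [(hC x).2] at this
  · rintro h ⟨_, x, hx, rfl⟩ (_ | i)
    · have h1 : Ψ ⟨starHom d x, x, hx, rfl⟩ none = none := (hC ⟨x, hx⟩).1
      rw [h1]
      exact (h ⟨x, hx⟩).1
    · have h1 : Ψ ⟨starHom d x, x, hx, rfl⟩ (some i) = some (Φ ⟨x, hx⟩ i) := (hC ⟨x, hx⟩).2 i
      rw [h1]
      exact (h ⟨x, hx⟩).2 i

/-- The type of a cone framework with its cone joint at the origin is determined by the type of
its central projection. -/
theorem isConeType_of_proj {p : V → E d} (hp : Function.Injective p) (hΦ : p ∈ symConfig G S Φ)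
    {q : V → E (d + 1)} (hqp : ∀ i, proj (q i) = p i)
    (hq : Function.Injective (coneConfig q))
    (hΨ : coneConfig q ∈ symConfig (coneGraph G) (starGroup S) Ψ) : IsConeType Φ Ψ := by
  intro x
  -- Each `x^*` fixes the origin, and by injectivity only the cone joint lies there.
  have h0 : Ψ ⟨starElem x, starElem_mem x⟩ none = none := by
    apply hq
    rw [← hΨ]
    exact map_zero (starElem (x : O d))
  refine ⟨h0, fun i => ?_⟩
  have h1 := hΨ ⟨starElem x, starElem_mem x⟩ (some i)
  rcases hj : Ψ ⟨starElem x, starElem_mem x⟩ (some i) with _ | j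
  · exact absurd ((Ψ ⟨starElem x, starElem_mem x⟩).injective (hj.trans h0.symm)) (by simp)
  · rw [hj] at h1
    have h2 : starElem x (q i) = q j := h1
    congr 1
    apply hp
    rw [← hqp j, ← h2, proj_starElem, hqp, hΦ x i]

/-- The central projection, from the cone joint, of a symmetric cone configuration. -/
noncomputable def projConfig (hC : IsConeType Φ Ψ) (w : symConfig (coneGraph G) (starGroup S) Ψ) :
    symConfig G S Φ :=
  ⟨fun i => proj (w.1 (some i) - w.1 none), fun x i => by
    have h := (mem_symConfig_cone hC).1 w.2 x
    rw [← proj_starElem, map_sub, h.1, h.2]⟩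

/-- The vectors fixed by a group of isometries. -/
def fixedSpace {m : ℕ} (T : Subgroup (O m)) : Submodule ℝ (E m) where
  carrier := {b | ∀ x ∈ T, x b = b}
  add_mem' ha hb x hx := by rw [map_add, ha x hx, hb x hx]
  zero_mem' x _ := map_zero x
  smul_mem' c b hb x hx := by rw [map_smul, hb x hx]

/-- The height of the joint `i` above the cone joint. -/
noncomputable def height (w : Option V → E (d + 1)) (i : V) : ℝ := (w (some i) - w none) (Fin.last d)

theorem height_symm (hC : IsConeType Φ Ψ) (w : symConfig (coneGraph G) (starGroup S) Ψ)
    (x : S) (i : V) : height w.1 (Φ x i) = height w.1 i := by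
  have h := (mem_symConfig_cone hC).1 w.2 x
  have h1 : w.1 (some (Φ x i)) - w.1 none = starElem x (w.1 (some i) - w.1 none) := by
    rw [map_sub, h.1, h.2]
  rw [height, h1, starElem_last, height]

theorem sub_eq_height_smul (hC : IsConeType Φ Ψ) (w : symConfig (coneGraph G) (starGroup S) Ψ)
    {i : V} (hw : height w.1 i ≠ 0) :
    w.1 (some i) - w.1 none = height w.1 i • snocPt ((projConfig hC w).1 i) 1 :=
  (smul_snocPt_proj hw).symm

/-- The velocity assigned to a joint of the cone framework at height `h` above `r` by a velocity
`u` of its projection `r`. -/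
noncomputable def liftVelocity (h : ℝ) (r u : E d) : E (d + 1) := h • snocPt u (-inner ℝ r u)

theorem liftVelocity_add (h : ℝ) (r u v : E d) :
    liftVelocity h r (u + v) = liftVelocity h r u + liftVelocity h r v := by
  rw [liftVelocity, inner_add_right, neg_add, snocPt_add, smul_add]; rfl

theorem liftVelocity_smul (h : ℝ) (r : E d) (c : ℝ) (u : E d) :
    liftVelocity h r (c • u) = c • liftVelocity h r u := by
  rw [liftVelocity, inner_smul_right, ← mul_neg, snocPt_smul, smul_comm]; rfl

theorem starElem_liftVelocity (x : O d) (h : ℝ) (r u : E d) :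
    starElem x (liftVelocity h r u) = liftVelocity h (x r) (x u) := by
  rw [liftVelocity, map_smul, starElem_snocPt, ← x.inner_map_map r u]; rfl

/-- The last coordinate in `liftVelocity` is chosen for this: the lifted velocity is tangent to the
sphere about the cone joint, so cone edges keep their length to first order. -/
theorem inner_liftVelocity_self (h : ℝ) (r u : E d) :
    inner ℝ (h • snocPt r 1) (liftVelocity h r u) = 0 := by
  rw [liftVelocity, inner_smul_left, inner_smul_right, inner_snocPt]
  simp

/-- The diagonal terms vanish by tangency and only the cross terms, carrying the factor `h * k`,
survive. With nonzero heights, the edge condition upstairs is therefore equivalent to the one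
downstairs. -/
theorem inner_sub_liftVelocity (h k : ℝ) (r s u v : E d) :
    inner ℝ (h • snocPt r 1 - k • snocPt s 1) (liftVelocity h r u - liftVelocity k s v) =
      h * k * inner ℝ (r - s) (u - v) := by
  simp only [liftVelocity, inner_sub_left, inner_sub_right, inner_smul_left, inner_smul_right,
    inner_snocPt, RCLike.conj_to_real]
  ring

/-- The lift of a translation and an infinitesimal motion of the projection to an
infinitesimal motion of the cone framework. -/
noncomputable def coneLift (hC : IsConeType Φ Ψ) (w : symConfig (coneGraph G) (starGroup S) Ψ) :
    fixedSpace (starGroup S) × symConfig G S Φ →ₗ[ℝ]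
      symConfig (coneGraph G) (starGroup S) Ψ where
  toFun z := ⟨fun o => o.elim z.1.1
      (fun i => z.1.1 + liftVelocity (height w.1 i) ((projConfig hC w).1 i) (z.2.1 i)), by
    rw [mem_symConfig_cone hC]
    intro x
    have hb := z.1.2 _ (starElem_mem x)
    refine ⟨hb, fun i => ?_⟩
    change starElem x (z.1.1 + liftVelocity (height w.1 i) ((projConfig hC w).1 i) (z.2.1 i)) =
      z.1.1 + liftVelocity (height w.1 (Φ x i)) ((projConfig hC w).1 (Φ x i)) (z.2.1 (Φ x i))
    rw [map_add, hb, starElem_liftVelocity, height_symm hC w, z.2.2 x i, (projConfig hC w).2 x i]⟩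
  map_add' y z := by
    ext1; funext o
    rcases o with _ | i
    · rfl
    · change (y.1.1 + z.1.1) + liftVelocity _ _ (y.2.1 i + z.2.1 i) =
        (y.1.1 + liftVelocity _ _ (y.2.1 i)) + (z.1.1 + liftVelocity _ _ (z.2.1 i))
      rw [liftVelocity_add]; abel
  map_smul' c z := by
    ext1; funext o
    rcases o with _ | i
    · rfl
    · change c • z.1.1 + liftVelocity _ _ (c • z.2.1 i) =
        c • (z.1.1 + liftVelocity _ _ (z.2.1 i))
      rw [liftVelocity_smul, smul_add]

variable (hC : IsConeType Φ Ψ) (w : symConfig (coneGraph G) (starGroup S) Ψ)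

theorem coneLift_none (z) : (coneLift hC w z).1 none = z.1.1 := rfl

theorem coneLift_some_sub (z) (i : V) : (coneLift hC w z).1 (some i) - (coneLift hC w z).1 none =
    liftVelocity (height w.1 i) ((projConfig hC w).1 i) (z.2.1 i) :=
  add_sub_cancel_left z.1.1 _

theorem coneLift_injective (hw : ∀ i, height w.1 i ≠ 0) : Function.Injective (coneLift hC w) := by
  rw [injective_iff_map_eq_zero]
  intro z hz
  have h1 : z.1.1 = 0 := by rw [← coneLift_none hC w, hz]; rfl
  refine Prod.ext (Subtype.ext h1) (Subtype.ext (funext fun i => ?_))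
  have h2 := coneLift_some_sub hC w z i
  rw [hz] at h2
  have h3 : liftVelocity (height w.1 i) ((projConfig hC w).1 i) (z.2.1 i) = 0 := by
    rw [← h2]; exact sub_self _
  have h4 := congrArg initPt ((smul_eq_zero.1 h3).resolve_left (hw i))
  rw [initPt_snocPt] at h4
  rw [h4]
  ext k; rfl

theorem coneLift_mem_infFlex_iff (hw : ∀ i, height w.1 i ≠ 0) (z) :
    coneLift hC w z ∈ infFlex w ↔ z.2 ∈ infFlex (projConfig hC w) := by
  have hedge : ∀ i j, inner ℝ (w.1 (some i) - w.1 (some j))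
      ((coneLift hC w z).1 (some i) - (coneLift hC w z).1 (some j)) =
      height w.1 i * height w.1 j *
        inner ℝ ((projConfig hC w).1 i - (projConfig hC w).1 j) (z.2.1 i - z.2.1 j) := by
    intro i j
    rw [← sub_sub_sub_cancel_right (w.1 (some i)) _ (w.1 none),
      ← sub_sub_sub_cancel_right ((coneLift hC w z).1 (some i)) _ ((coneLift hC w z).1 none), coneLift_some_sub,
      coneLift_some_sub, sub_eq_height_smul hC w (hw i), sub_eq_height_smul hC w (hw j),
      inner_sub_liftVelocity]
  have hapex : ∀ i, inner ℝ (w.1 (some i) - w.1 none)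
      ((coneLift hC w z).1 (some i) - (coneLift hC w z).1 none) = 0 := by
    intro i
    rw [coneLift_some_sub, sub_eq_height_smul hC w (hw i), inner_liftVelocity_self]
  constructor
  · intro h i j hij
    have h1 := h (some i) (some j) hij
    rw [hedge] at h1
    exact (mul_eq_zero.1 h1).resolve_left (mul_ne_zero (hw i) (hw j))
  · rintro h (_ | i) (_ | j) hij
    · exact hij.elim
    · rw [← neg_sub (w.1 (some j)), ← neg_sub ((coneLift hC w z).1 (some j)), inner_neg_neg]
      exact hapex j
    · exact hapex i
    · rw [hedge, h i j hij, mul_zero]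

/-- The translation is the velocity of the cone joint, and the base velocity consists of the first
`d` relative coordinates divided by the height. The cone edge condition then forces the last
coordinate to be the one in `liftVelocity`. -/
theorem exists_coneLift_eq (hw : ∀ i, height w.1 i ≠ 0)
    {z : symConfig (coneGraph G) (starGroup S) Ψ} (hz : z ∈ infFlex w) :
    ∃ y, coneLift hC w y = z := by
  have hsym := (mem_symConfig_cone hC).1 z.2
  let u : symConfig G S Φ := ⟨fun i => (height w.1 i)⁻¹ • initPt (z.1 (some i) - z.1 none), by
    intro x i
    rw [map_smul, ← initPt_starElem, map_sub, (hsym x).1, (hsym x).2, ← height_symm hC w x i]⟩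
  let b : fixedSpace (starGroup S) := ⟨z.1 none, by
    exact forall_mem_starGroup.2 fun x hx => (hsym ⟨x, hx⟩).1⟩
  refine ⟨(b, u), Subtype.ext (funext fun o => ?_)⟩
  rcases o with _ | i
  · rfl
  · have key : liftVelocity (height w.1 i) ((projConfig hC w).1 i) (u.1 i) =
        z.1 (some i) - z.1 none := by
      have h1 := hz (some i) none trivial
      rw [sub_eq_height_smul hC w (hw i)] at h1
      set r := (projConfig hC w).1 i
      set v := z.1 (some i) - z.1 none with hv
      rw [inner_smul_left, RCLike.conj_to_real] at h1
      have h2 := (mul_eq_zero.1 h1).resolve_left (hw i)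
      rw [← snocPt_initPt v, inner_snocPt, one_mul] at h2
      change height w.1 i • snocPt ((height w.1 i)⁻¹ • initPt v)
        (-inner ℝ r ((height w.1 i)⁻¹ • initPt v)) = v
      rw [← snocPt_smul, smul_inv_smul₀ (hw i), inner_smul_right, mul_neg,
        mul_inv_cancel_left₀ (hw i), ← eq_neg_of_add_eq_zero_right h2, snocPt_initPt]
    change z.1 none + liftVelocity (height w.1 i) ((projConfig hC w).1 i) (u.1 i) = _
    rw [key, add_sub_cancel]

/-- The skew map of `E (d + 1)` given by a skew map `A` and a translation `b` of `E d`. -/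
noncomputable def liftMotion (A : E d →L[ℝ] E d) (b : E d) : E (d + 1) →L[ℝ] E (d + 1) :=
  LinearMap.toContinuousLinearMap
    { toFun w := snocPt (A (initPt w) + w (Fin.last d) • b) (-inner ℝ b (initPt w))
      map_add' v w := by
        rw [← snocPt_add, initPt_add, map_add, inner_add_right, PiLp.add_apply, add_smul]
        congr 1 <;> abel
      map_smul' c w := by
        rw [RingHom.id_apply, ← snocPt_smul, initPt_smul, map_smul, inner_smul_right,
          PiLp.smul_apply, smul_add, smul_smul, mul_neg, smul_eq_mul] }

theorem liftMotion_apply (A : E d →L[ℝ] E d) (b : E d) (w : E (d + 1)) : liftMotion A b w =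
    snocPt (A (initPt w) + w (Fin.last d) • b) (-inner ℝ b (initPt w)) := rfl

/-- The linear part of the motion of the hyperplane `x_{d+1} = 1` given by a linear map
of `E (d + 1)`. -/
noncomputable def restrictMotion (A : E (d + 1) →L[ℝ] E (d + 1)) : E d →L[ℝ] E d :=
  LinearMap.toContinuousLinearMap
    { toFun v := initPt (A (snocPt v 0))
      map_add' v w := by
        rw [← initPt_add, ← map_add, ← snocPt_add, add_zero]
      map_smul' c v := by
        rw [RingHom.id_apply, ← initPt_smul, ← map_smul, ← snocPt_smul, mul_zero] }

/-- A skew map of `E (d + 1)` has blocks `A`, `b`, `-bᵀ`, `0` with `A` skew. It sends `(r, 1)` to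
`(A r + b, -⟪b, r⟫)`, and `⟪b, r⟫ = ⟪r, A r + b⟫` as `⟪r, A r⟫ = 0`, so the image is the lift of the
velocity `A r + b`. Commuting with `S^*` means that `A` commutes with `S` and that `S` fixes `b`. -/
theorem coneLift_mem_range_motionVelocity_iff (hw : ∀ i, height w.1 i ≠ 0) (z) :
    coneLift hC w z ∈ LinearMap.range (motionVelocity w) ↔
      z.2 ∈ LinearMap.range (motionVelocity (projConfig hC w)) := by
  rw [mem_range_motionVelocity, mem_range_motionVelocity]
  constructor
  · rintro ⟨⟨A, b⟩, ⟨hskew, hcomm⟩, hu⟩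
    rw [forall_mem_starGroup] at hcomm
    refine ⟨(restrictMotion A, initPt (A (snocPt 0 1))), ⟨fun v => ?_, fun x hx => ⟨fun v => ?_, ?_⟩⟩,
      fun i => ?_⟩
    · change inner ℝ (initPt (A (snocPt v 0))) v = 0
      have h1 := hskew (snocPt v 0)
      change inner ℝ (A (snocPt v 0)) (snocPt v 0) = 0 at h1
      rwa [← snocPt_initPt (A (snocPt v 0)), inner_snocPt, mul_zero, add_zero] at h1
    · change x (initPt (A (snocPt v 0))) = initPt (A (snocPt (x v) 0))
      rw [← initPt_starElem]
      have h1 := (hcomm x hx).1 (snocPt v 0)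
      change starElem x (A (snocPt v 0)) = A (starElem x (snocPt v 0)) at h1
      rw [h1, starElem_snocPt]
    · change x (initPt (A (snocPt 0 1))) = initPt (A (snocPt 0 1))
      rw [← initPt_starElem]
      have h1 := (hcomm x hx).1 (snocPt 0 1)
      change starElem x (A (snocPt 0 1)) = A (starElem x (snocPt 0 1)) at h1
      rw [h1, starElem_snocPt, map_zero]
    · change z.2.1 i = initPt (A (snocPt ((projConfig hC w).1 i) 0)) + initPt (A (snocPt 0 1))
      have h1 := coneLift_some_sub hC w z i
      rw [hu, hu] at h1
      change (A (w.1 (some i)) + b) - (A (w.1 none) + b) = _ at h1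
      rw [add_sub_add_right_eq_sub, ← map_sub, sub_eq_height_smul hC w (hw i), map_smul,
        liftVelocity] at h1
      have h2 := congrArg initPt (smul_right_injective _ (hw i) h1)
      rw [initPt_snocPt] at h2
      rw [← h2, ← initPt_add, ← map_add, ← snocPt_add, add_zero, zero_add]
  · rintro ⟨⟨A, b⟩, ⟨hskew, hcomm⟩, hu⟩
    change ∀ v, inner ℝ (A v) v = 0 at hskew
    change ∀ x ∈ S, (∀ v, x (A v) = A (x v)) ∧ x b = b at hcomm
    change ∀ i, z.2.1 i = A ((projConfig hC w).1 i) + b at hu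
    have hlift : ∀ x ∈ S, ∀ v, starElem x (liftMotion A b v) = liftMotion A b (starElem x v) := by
      intro x hx v
      rw [liftMotion_apply, liftMotion_apply, starElem_snocPt, map_add, map_smul, (hcomm x hx).1,
        (hcomm x hx).2, initPt_starElem, starElem_last]
      congr 2
      rw [← x.inner_map_map b, (hcomm x hx).2]
    -- The translation part is adjusted so that the cone joint receives the prescribed velocity.
    refine ⟨(liftMotion A b, z.1.1 - liftMotion A b (w.1 none)),
      ⟨fun v => ?_, forall_mem_starGroup.2 fun x hx => ⟨hlift x hx, ?_⟩⟩, fun o => ?_⟩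
    · change inner ℝ (liftMotion A b v) v = 0
      conv_lhs => rw [liftMotion_apply]; enter [3]; rw [← snocPt_initPt v]
      rw [inner_snocPt, inner_add_left, hskew, inner_smul_left, RCLike.conj_to_real]
      ring
    · change starElem x (z.1.1 - liftMotion A b (w.1 none)) = z.1.1 - liftMotion A b (w.1 none)
      rw [map_sub, hlift x hx, ((mem_symConfig_cone hC).1 w.2 ⟨x, hx⟩).1,
        z.1.2 _ (starElem_mem ⟨x, hx⟩)]
    · rcases o with _ | i
      · change z.1.1 = liftMotion A b (w.1 none) + (z.1.1 - liftMotion A b (w.1 none))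
        abel
      · change (coneLift hC w z).1 (some i) =
          liftMotion A b (w.1 (some i)) + (z.1.1 - liftMotion A b (w.1 none))
        have h1 := coneLift_some_sub hC w z i
        rw [coneLift_none, sub_eq_iff_eq_add] at h1
        have h2 : liftMotion A b (w.1 (some i)) - liftMotion A b (w.1 none) =
            liftVelocity (height w.1 i) ((projConfig hC w).1 i) (z.2.1 i) := by
          rw [← map_sub, sub_eq_height_smul hC w (hw i), map_smul, liftMotion_apply, initPt_snocPt,
            snocPt_last, one_smul, liftVelocity, hu, inner_add_right,
            real_inner_comm (A ((projConfig hC w).1 i)), hskew, zero_add,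
            real_inner_comm b]
        rw [h1, ← h2]
        abel

theorem infFlex_le_iff_of_cone (hw : ∀ i, height w.1 i ≠ 0) :
    infFlex w ≤ LinearMap.range (motionVelocity w) ↔
      infFlex (projConfig hC w) ≤ LinearMap.range (motionVelocity (projConfig hC w)) := by
  constructor
  · intro h u hu
    exact (coneLift_mem_range_motionVelocity_iff hC w hw (0, u)).1
      (h ((coneLift_mem_infFlex_iff hC w hw (0, u)).2 hu))
  · intro h z hz
    obtain ⟨y, rfl⟩ := exists_coneLift_eq hC w hw hz
    exact (coneLift_mem_range_motionVelocity_iff hC w hw y).2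
      (h ((coneLift_mem_infFlex_iff hC w hw y).1 hz))

/-- The first summand is independent of `w`, which is what lets minimality of dimension pass from
the base to the cone. -/
theorem finrank_infFlex_cone [Fintype V] (hw : ∀ i, height w.1 i ≠ 0) :
    Module.finrank ℝ (infFlex w) = Module.finrank ℝ (fixedSpace (starGroup S)) +
      Module.finrank ℝ (infFlex (projConfig hC w)) := by
  let ι : fixedSpace (starGroup S) × infFlex (projConfig hC w) →ₗ[ℝ]
      symConfig (coneGraph G) (starGroup S) Ψ :=
    coneLift hC w ∘ₗ LinearMap.prodMap LinearMap.id (infFlex (projConfig hC w)).subtype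
  have hι : Function.Injective ι :=
    (coneLift_injective hC w hw).comp (Function.injective_id.prodMap Subtype.val_injective)
  have hrange : LinearMap.range ι = infFlex w := by
    ext z
    constructor
    · rintro ⟨y, rfl⟩
      exact (coneLift_mem_infFlex_iff hC w hw _).2 y.2.2
    · intro hz
      obtain ⟨y, rfl⟩ := exists_coneLift_eq hC w hw hz
      exact ⟨(y.1, ⟨y.2, (coneLift_mem_infFlex_iff hC w hw y).1 hz⟩), rfl⟩
  have := Module.Free.of_divisionRing ℝ (infFlex (projConfig hC w))
  rw [← hrange, LinearMap.finrank_range_of_inj hι, Module.finrank_prod]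

end ConeType

/-! ### Transfer of finite flexes. -/

section Transfer

variable {V : Type*} {d : ℕ} {G : SimpleGraph V} {S : Subgroup (O d)} {Φ : S → (G ≃g G)}
  {Ψ : starGroup S → (coneGraph G ≃g coneGraph G)}

theorem starElem_injective : Function.Injective (starElem (d := d)) := by
  intro x y h
  ext1 v
  have h1 := congrArg (fun z : O (d + 1) => initPt (z (snocPt v 0))) h
  simpa only [starElem_snocPt, initPt_snocPt] using h1

/-- The type of `S^*`-symmetric configurations of `G` corresponding to the type `Φ` of `S`. -/
noncomputable def starType (Φ : S → (G ≃g G)) (y : starGroup S) : G ≃g G :=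
  Φ ⟨y.2.choose, y.2.choose_spec.1⟩

theorem starType_starElem (Φ : S → (G ≃g G)) (x : S) :
    starType Φ ⟨starElem x, starElem_mem x⟩ = Φ x := by
  have h := (starElem_mem x).choose_spec.2
  exact congrArg Φ (Subtype.ext (starElem_injective h))

theorem mem_symConfig_starType {r : V → E (d + 1)} : r ∈ symConfig G (starGroup S) (starType Φ) ↔
    ∀ (x : S) (i : V), starElem x (r i) = r (Φ x i) := by
  constructor
  · intro h x i
    rw [← starType_starElem Φ x]
    exact h ⟨starElem x, starElem_mem x⟩ i
  · rintro h ⟨_, x, hx, rfl⟩ i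
    have h1 : starType Φ ⟨starHom d x, x, hx, rfl⟩ = Φ ⟨x, hx⟩ := starType_starElem Φ ⟨x, hx⟩
    rw [h1]
    exact h ⟨x, hx⟩ i

theorem mem_symConfig_starType_of_cone (hC : IsConeType Φ Ψ) {w : Option V → E (d + 1)}
    (hw : w ∈ symConfig (coneGraph G) (starGroup S) Ψ) :
    (fun i => w (some i)) ∈ symConfig G (starGroup S) (starType Φ) :=
  mem_symConfig_starType.2 fun x => ((mem_symConfig_cone hC).1 hw x).2

theorem coneConfig_mem_symConfig (hC : IsConeType Φ Ψ) {r : V → E (d + 1)}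
    (hr : r ∈ symConfig G (starGroup S) (starType Φ)) :
    coneConfig r ∈ symConfig (coneGraph G) (starGroup S) Ψ :=
  (mem_symConfig_cone hC).2 fun x => ⟨map_zero _, mem_symConfig_starType.1 hr x⟩

theorem edgeFunction_cone_eq_iff {w z : Option V → E (d + 1)} :
    edgeFunction (coneGraph G) w = edgeFunction (coneGraph G) z ↔
      (∀ i, ‖w (some i) - w none‖ ^ 2 = ‖z (some i) - z none‖ ^ 2) ∧
      edgeFunction G (fun i => w (some i)) = edgeFunction G (fun i => z (some i)) := by
  rw [edgeFunction_eq_iff, edgeFunction_eq_iff]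
  constructor
  · exact fun h => ⟨fun i => h (some i) none trivial, fun i j hij => h (some i) (some j) hij⟩
  · rintro ⟨h1, h2⟩ (_ | i) (_ | j) hij
    · exact hij.elim
    · rw [norm_sub_rev, h1, norm_sub_rev]
    · exact h1 i
    · exact h2 i j hij

theorem edgeFunction_top_cone_eq_iff {w z : Option V → E (d + 1)} :
    edgeFunction (⊤ : SimpleGraph (Option V)) w = edgeFunction ⊤ z ↔
      (∀ i, ‖w (some i) - w none‖ ^ 2 = ‖z (some i) - z none‖ ^ 2) ∧
      edgeFunction (⊤ : SimpleGraph V) (fun i => w (some i)) =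
        edgeFunction ⊤ (fun i => z (some i)) := by
  rw [edgeFunction_top_eq_iff, edgeFunction_top_eq_iff]
  constructor
  · exact fun h => ⟨fun i => h (some i) none, fun i j => h (some i) (some j)⟩
  · rintro ⟨h1, h2⟩ (_ | i) (_ | j)
    · simp
    · rw [norm_sub_rev, h1, norm_sub_rev]
    · exact h1 i
    · exact h2 i j

theorem hemisphereConfig_eq : hemisphereConfig V d =
    sphereConfig V d ∩ {x | ∀ i, 0 < x i (Fin.last d)} :=
  Set.ext fun _ => forall_and

variable [Fintype V]

theorem analyticAt_coord {m : ℕ} {x : ℝ → V → E m} {t : ℝ} (hx : AnalyticAt ℝ x t) (i : V) :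
    AnalyticAt ℝ (fun s => x s i) t :=
  ((ContinuousLinearMap.proj (R := ℝ) (φ := fun _ : V => E m) i).analyticAt _).comp hx

theorem HasSymFlexIn.mono {m : ℕ} {A B : Set (V → E m)} (hAB : A ⊆ B) {T : Subgroup (O m)}
    {p : V → E m} (h : HasSymFlexIn A G T p) : HasSymFlexIn B G T p := by
  obtain ⟨Θ, hΘ, x, h1, h2, h3, h4⟩ := h
  exact ⟨Θ, hΘ, x, h1, h2, fun t ht => ⟨hAB (h3 t ht).1, (h3 t ht).2⟩, h4⟩

/-- A flex of a framework lying in an open set of configurations can be shortened so as to stay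
in this set. -/
theorem HasSymFlexIn.inter_open {m : ℕ} {A U : Set (V → E m)} (hU : IsOpen U) {T : Subgroup (O m)}
    {p : V → E m} (hp : p ∈ U) (h : HasSymFlexIn A G T p) : HasSymFlexIn (A ∩ U) G T p := by
  obtain ⟨Θ, hΘ, x, hxan, hx0, hx, hxne⟩ := h
  have hcont : ContinuousAt x 0 := (hxan 0 ⟨le_rfl, zero_le_one⟩).continuousAt
  obtain ⟨ε, hε, hball⟩ := Metric.eventually_nhds_iff_ball.1
    (hcont.eventually_mem (hU.mem_nhds (hx0.symm ▸ hp)))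
  -- The bound `c < ε` keeps the path in the open set; `c ≤ 1` keeps the rescaled time in `[0,1]`.
  let c := min (ε / 2) 1
  have hc0 : 0 < c := lt_min (by linarith) zero_lt_one
  have hc1 : c ≤ 1 := min_le_right _ _
  have hcε : c < ε := (min_le_left _ _).trans_lt (by linarith)
  have hIcc : ∀ t ∈ Set.Icc (0 : ℝ) 1, c * t ∈ Set.Icc (0 : ℝ) 1 := fun t ht =>
    ⟨mul_nonneg hc0.le ht.1, mul_le_one₀ hc1 ht.1 ht.2⟩
  refine ⟨Θ, hΘ, fun t => x (c * t), fun t ht => ?_, by simp [hx0], fun t ht => ?_, fun t ht => ?_⟩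
  · exact AnalyticAt.comp (g := x) (f := fun t => c * t) (hxan _ (hIcc t ht))
      (analyticAt_const.mul analyticAt_id)
  · refine ⟨⟨(hx _ (hIcc t ht)).1, hball _ ?_⟩, (hx _ (hIcc t ht)).2⟩
    rw [mem_ball_zero_iff, Real.norm_eq_abs, abs_of_nonneg (hIcc t ht).1]
    exact (mul_le_of_le_one_right hc0.le ht.2).trans_lt hcε
  · exact hxne _ ⟨mul_pos hc0 ht.1, (hIcc t ⟨ht.1.le, ht.2⟩).2⟩

/-- The cone joint can be kept at the origin along a symmetric flex of the cone framework. -/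
theorem hasSymFlex_cone_iff_apex (hC : IsConeType Φ Ψ) {q : V → E (d + 1)}
    (hq : Function.Injective (coneConfig q))
    (hΨ : coneConfig q ∈ symConfig (coneGraph G) (starGroup S) Ψ) :
    HasSymFlex (coneGraph G) (starGroup S) (coneConfig q) ↔
      HasSymFlexIn {x | x none = 0} (coneGraph G) (starGroup S) (coneConfig q) := by
  refine ⟨fun h => ?_, fun h => h.mono (Set.subset_univ _)⟩
  obtain ⟨Θ, hΘ, x, hxan, hx0, hx, hxne⟩ := h
  obtain rfl := type_unique hq hΨ hΘ
  have hdiff : ∀ t o o', (x t o - x t none) - (x t o' - x t none) = x t o - x t o' := fun t o o' =>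
    sub_sub_sub_cancel_right _ _ _
  -- Subtracting the position of the cone joint changes no distances, and it preserves the type
  -- because the symmetries fix that joint.
  refine ⟨Ψ, hΨ, fun t o => x t o - x t none, fun t ht => ?_, ?_, fun t ht => ⟨sub_self _, ?_, ?_⟩,
    fun t ht => ?_⟩
  · exact AnalyticAt.pi fun o =>
      (analyticAt_coord (hxan t ht) o).sub (analyticAt_coord (hxan t ht) none)
  · funext o
    change x 0 o - x 0 none = _
    rw [hx0]
    exact sub_zero _
  · have h := (mem_symConfig_cone hC).1 (hx t ht).2.1
    refine (mem_symConfig_cone hC).2 fun y => ⟨?_, fun i => ?_⟩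
    · simp only [sub_self, map_zero]
    · simp only [map_sub, (h y).1, (h y).2]
  · rw [← (hx t ht).2.2, edgeFunction_eq_iff]
    intro i j _
    rw [hdiff]
  · intro h
    refine hxne t ht ?_
    rw [← h, edgeFunction_top_eq_iff]
    intro i j
    rw [hdiff]

/-- Flexes of a cone framework with unit cone edges, with the cone joint fixed at the origin, are
flexes of the base framework on the sphere. -/
theorem hasSymFlexIn_apex_iff_sphere (hC : IsConeType Φ Ψ) {q : V → E (d + 1)}
    (hq : Function.Injective (coneConfig q))
    (hΨ : coneConfig q ∈ symConfig (coneGraph G) (starGroup S) Ψ) (hqS : q ∈ sphereConfig V d) :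
    HasSymFlexIn {x | x none = 0} (coneGraph G) (starGroup S) (coneConfig q) ↔
      HasSymFlexIn (sphereConfig V d) G (starGroup S) q := by
  have hqinj : Function.Injective q := fun i j hij => Option.some_injective _ (hq hij)
  have hqΦ : q ∈ symConfig G (starGroup S) (starType Φ) := mem_symConfig_starType_of_cone hC hΨ
  constructor
  · rintro ⟨Θ, hΘ, x, hxan, hx0, hx, hxne⟩
    obtain rfl := type_unique hq hΨ hΘ
    refine ⟨starType Φ, hqΦ, fun t i => x t (some i), fun t ht => ?_, by simp only [hx0]; rfl,
      fun t ht => ⟨fun i => ?_, ?_, ?_⟩, fun t ht => ?_⟩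
    · exact AnalyticAt.pi fun i => analyticAt_coord (hxan t ht) (some i)
    · have h1 := (edgeFunction_cone_eq_iff.1 (hx t ht).2.2).1 i
      have h0 : x t none = 0 := (hx t ht).1
      have h2 : ‖coneConfig q (some i) - coneConfig q none‖ = 1 := by
        change ‖q i - 0‖ = 1
        rw [sub_zero]; exact hqS i
      rw [h0, sub_zero, h2, sq_eq_sq₀ (norm_nonneg _) zero_le_one] at h1
      exact h1
    · exact mem_symConfig_starType_of_cone hC (hx t ht).2.1
    · exact (edgeFunction_cone_eq_iff.1 (hx t ht).2.2).2
    · intro h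
      -- Cone edges keep their length along the flex, so the failure of congruence must be visible
      -- among the base joints.
      exact hxne t ht (edgeFunction_top_cone_eq_iff.2
        ⟨(edgeFunction_cone_eq_iff.1 (hx t ⟨ht.1.le, ht.2⟩).2.2).1, h⟩)
  · rintro ⟨Θ, hΘ, x, hxan, hx0, hx, hxne⟩
    obtain rfl := type_unique hqinj hqΦ hΘ
    refine ⟨Ψ, hΨ, fun t => coneConfig (x t), fun t ht => ?_, by simp only [hx0],
      fun t ht => ⟨rfl, ?_, ?_⟩, fun t ht h => ?_⟩
    · refine AnalyticAt.pi fun o => ?_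
      rcases o with _ | i
      · exact analyticAt_const
      · exact analyticAt_coord (hxan t ht) i
    · exact coneConfig_mem_symConfig hC (hx t ht).2.1
    · refine edgeFunction_cone_eq_iff.2 ⟨fun i => ?_, (hx t ht).2.2⟩
      change ‖x t i - 0‖ ^ 2 = ‖q i - 0‖ ^ 2
      rw [sub_zero, sub_zero, (hx t ht).1 i, hqS i]
    · exact hxne t ht (edgeFunction_top_cone_eq_iff.1 h).2

/-- A regular framework has a symmetric finite flex if and only if its cone has one. -/
theorem hasSymFlex_iff_cone (hC : IsConeType Φ Ψ) {p : V → E d} (hp : Function.Injective p)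
    (hΦ : p ∈ symConfig G S Φ) (hreg : IsSRegularPoint G S p) {q : V → E (d + 1)}
    (hq0 : ∀ i, q i (Fin.last d) ≠ 0) (hqp : ∀ i, proj (q i) = p i)
    (hq : Function.Injective (coneConfig q))
    (hΨ : coneConfig q ∈ symConfig (coneGraph G) (starGroup S) Ψ) :
    HasSymFlex G S p ↔ HasSymFlex (coneGraph G) (starGroup S) (coneConfig q) := by
  obtain ⟨Θ, hΘ, hmax⟩ := hreg
  obtain rfl := type_unique hp hΦ hΘ
  let P : symConfig G S Φ := ⟨p, hΦ⟩
  let Q : symConfig (coneGraph G) (starGroup S) Ψ := ⟨coneConfig q, hΨ⟩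
  have hmin : ∀ r : symConfig G S Φ, Module.finrank ℝ (infFlex P) ≤ Module.finrank ℝ (infFlex r) := by
    intro r
    have h1 := symRank_add_finrank_infFlex r
    have h2 := symRank_add_finrank_infFlex P
    have h3 : symRank G S Φ r ≤ symRank G S Φ P := hmax r
    omega
  have hproj : projConfig hC Q = P := by
    refine Subtype.ext (funext fun i => ?_)
    change proj (q i - 0) = p i
    rw [sub_zero, hqp]
  have hheight : ∀ i, height Q.1 i ≠ 0 := by
    intro i
    change (q i - 0) (Fin.last d) ≠ 0
    rw [sub_zero]
    exact hq0 i
  -- Local minimality is enough here: nonzero heights persist near `Q`, and there every projection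
  -- is a configuration of type `Φ`, to which the regularity of `p` applies.
  have hQmin : ∀ᶠ w in 𝓝 Q, Module.finrank ℝ (infFlex Q) ≤ Module.finrank ℝ (infFlex w) := by
    have hev : ∀ᶠ w : symConfig (coneGraph G) (starGroup S) Ψ in 𝓝 Q, ∀ i, height w.1 i ≠ 0 := by
      refine eventually_all.2 fun i => ContinuousAt.eventually_ne ?_ (hheight i)
      have h : ∀ o, Continuous fun w : symConfig (coneGraph G) (starGroup S) Ψ => w.1 o := fun o =>
        (continuous_apply o).comp continuous_subtype_val
      exact ((EuclideanSpace.proj (𝕜 := ℝ) (Fin.last d)).continuous.comp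
        ((h (some i)).sub (h none))).continuousAt
    filter_upwards [hev] with w hw
    rw [finrank_infFlex_cone hC Q hheight, finrank_infFlex_cone hC w hw, hproj]
    exact Nat.add_le_add_left (hmin _) _
  have hle := infFlex_le_iff_of_cone hC Q hheight
  rw [hproj] at hle
  constructor
  · intro h
    exact hasSymFlex_of_not_infFlex_le (p := Q) hQmin fun h' =>
      not_infFlex_le_of_hasSymFlex (p := P) hp h (hle.1 h')
  · intro h
    exact hasSymFlex_of_not_infFlex_le (p := P) (Eventually.of_forall hmin) fun h' =>
      not_infFlex_le_of_hasSymFlex (p := Q) hq h (hle.2 h')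

theorem isOpen_setOf_last_pos : IsOpen {x : V → E (d + 1) | ∀ i, 0 < x i (Fin.last d)} := by
  have h : ∀ i, Continuous fun x : V → E (d + 1) => x i (Fin.last d) := fun i =>
    (EuclideanSpace.proj (𝕜 := ℝ) (Fin.last d)).continuous.comp (continuous_apply i)
  have : {x : V → E (d + 1) | ∀ i, 0 < x i (Fin.last d)} =
      ⋂ i, {x : V → E (d + 1) | 0 < x i (Fin.last d)} := by
    ext x; simp
  rw [this]
  exact isOpen_iInter_of_finite fun i => isOpen_lt continuous_const (h i)

end Transfer

end ConeFlex

theorem mainTheorem3 {V : Type*} [Fintype V] (d : ℕ) (G : SimpleGraph V)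
    (S : Subgroup (ConeFlex.O d)) (p : V → ConeFlex.E d)
    (hp : ConeFlex.IsRealization G S p) (hreg : ConeFlex.IsSRegularPoint G S p)
    (q : V → ConeFlex.E (d + 1)) (hq0 : ∀ i, q i (Fin.last d) ≠ 0)
    (hqp : ∀ i, ConeFlex.proj (q i) = p i)
    (hqS : ConeFlex.IsRealization (ConeFlex.coneGraph G) (ConeFlex.starGroup S)
      (ConeFlex.coneConfig q)) :
    -- the cone framework in Euclidean `(d + 1)`-space
    (ConeFlex.HasSymFlex G S p ↔
      ConeFlex.HasSymFlex (ConeFlex.coneGraph G) (ConeFlex.starGroup S)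
        (ConeFlex.coneConfig q)) ∧
    -- the same, with the cone joint kept at the origin
    (ConeFlex.HasSymFlex G S p ↔
      ConeFlex.HasSymFlexIn {x | x none = 0} (ConeFlex.coneGraph G) (ConeFlex.starGroup S)
        (ConeFlex.coneConfig q)) ∧
    -- the framework `(G, q)` on the unit sphere
    (q ∈ ConeFlex.sphereConfig V d →
      (ConeFlex.HasSymFlex G S p ↔
        ConeFlex.HasSymFlexIn (ConeFlex.sphereConfig V d) G (ConeFlex.starGroup S) q)) ∧
    -- the framework `(G, q)` on the open upper half-sphere
    (q ∈ ConeFlex.hemisphereConfig V d →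
      (ConeFlex.HasSymFlex G S p ↔
        ConeFlex.HasSymFlexIn (ConeFlex.hemisphereConfig V d) G (ConeFlex.starGroup S) q)) := by
  obtain ⟨hpinj, Φ, hΦ⟩ := hp
  obtain ⟨hqinj, Ψ, hΨ⟩ := hqS
  have hC := ConeFlex.isConeType_of_proj hpinj hΦ hqp hqinj hΨ
  have h1 := ConeFlex.hasSymFlex_iff_cone hC hpinj hΦ hreg hq0 hqp hqinj hΨ
  have h2 := h1.trans (ConeFlex.hasSymFlex_cone_iff_apex hC hqinj hΨ)
  have h3 := fun h => h2.trans (ConeFlex.hasSymFlexIn_apex_iff_sphere hC hqinj hΨ h)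
  refine ⟨h1, h2, h3, fun h => ?_⟩
  rw [ConeFlex.hemisphereConfig_eq] at h ⊢
  exact (h3 h.1).trans ⟨fun hflex => hflex.inter_open ConeFlex.isOpen_setOf_last_pos h.2,
    fun hflex => hflex.mono Set.inter_subset_left⟩
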